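/- **Setting.** Let $\mathbf C,\mathbf N,\mathbf V$ be disjoint sets of constants, nulls and variables. Predicates have positive arity. An instance is a (possibly infinite) set of atoms over $\mathbf C\cup\mathbf N$; a database is a finite set of atoms over $\mathbf C$; $\mathsf{dom}(\cdot)$ denotes the set of terms that occur in an atom or a set of atoms. A TGD $\sigma$ is a constant-free sentence $\forall\bar x\forall\bar y(\phi(\bar x,\bar y)\to\exists\bar z\,\psi(\bar x,\bar z))$ with $\phi,\psi$ non-empty conjunctions of atoms; its frontier $\mathsf{fr}(\sigma)$ is the set of variables that occur in both body and head. It is guarded if some body atom contains all the body variables; the leftmost such atom is $\mathsf{guard}(\sigma)$. For a finite set $\Sigma$ of TGDs, $\mathsf{sch}(\Sigma)$ is the set of predicates that occur in $\Sigma$ and $\mathsf{ar}(\Sigma)$ is their maximal arity. **Chase.** A trigger for $\Sigma$ on an instance $I$ is a pair $(\sigma,h)$ with $\sigma\in\Sigma$ and $h$ a homomorphism from the body of $\sigma$ to $I$. Its result is the set of atoms obtained from the head of $\sigma$ by replacing each $x\in\mathsf{fr}(\sigma)$ by $h(x)$ and each existential variable $z$ by the null $\bot^{z}_{\sigma,h|_{\mathsf{fr}(\sigma)}}$,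 which is uniquely determined by $\sigma$, $h|_{\mathsf{fr}(\sigma)}$ and $z$. The trigger is active if its result is not contained in $I$. A (semi-oblivious) chase derivation of $D$ w.r.t. $\Sigma$ is a sequence $I_0=D,I_1,\dots$, where $I_{i+1}$ is the union of $I_i$ and the result of a trigger that is active on $I_i$; it is either infinite, or finite with no active trigger on its last instance. It is valid if it is finite, or infinite and fair (each trigger active on some $I_i$ is not an active trigger on some $I_j$, $j>i$). Its result is $\bigcup_i I_i$. All valid derivations of $D$ w.r.t. $\Sigma$ have the same result, denoted $\mathsf{chase}(D,\Sigma)$. We write $\Sigma\in\mathsf{CT}_D$ if every valid chase derivation of $D$ w.r.t. $\Sigma$ is finite; equivalently, if some valid chase derivation is finite. The depth of a constant is $0$, and that of a null $\bot^z_{\sigma,h}$ is $1+\max(\{\mathsf{depth}(h(x)) : x\in\mathsf{fr}(\sigma)\}\cup\{0\})$. If $\mathsf{chase}(D,\Sigma)$ is finite, $\mathsf{maxdepth}(D,\Sigma)$ is the maximal depth of a term of $\mathsf{chase}(D,\Sigma)$ ($0$ if there is no term); otherwise it is $\infty$. **Linearization.** The type $\mathsf{type}_{D,\Sigma}(\alpha)$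 of an atom $\alpha\in\mathsf{chase}(D,\Sigma)$ is $\{\beta\in\mathsf{chase}(D,\Sigma) : \mathsf{dom}(\beta)\subseteq\mathsf{dom}(\alpha)\}$, and $\mathsf{complete}(D,\Sigma)=\{\alpha\in\mathsf{chase}(D,\Sigma) : \mathsf{dom}(\alpha)\subseteq\mathsf{dom}(D)\}$. For tuples of equal length, $\bar t\simeq\bar u$ means that $t_i=t_j$ iff $u_i=u_j$ for all $i,j$. A $\Sigma$-type is a pair $\tau=(\alpha,T)$, where $\alpha=R(t_1,\dots,t_n)$ is an atom over the positive integers with $R\in\mathsf{sch}(\Sigma)$, $t_1=1$ and $1\le t_i\le\max_{j<i}t_j+1$ for $i\ge2$, and $T$ is a set of atoms other than $\alpha$ over $\mathsf{sch}(\Sigma)$ and the integers of $\alpha$. Put $\mathsf{guard}(\tau)=\alpha$ and $\mathsf{atoms}(\tau)=T\cup\{\alpha\}$, and for $\bar u\simeq\bar t$ let $\tau(\bar u)$ be obtained from $\mathsf{atoms}(\tau)$ by replacing each $t_i$ by $u_i$. For each $\tau$ let $[\tau]$ be a new predicate of the arity of $R$. * $\mathsf{lin}(D)$ (which depends also on $\Sigma$)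 is the set of all $[\tau](\bar t)$ such that $\tau$ is a $\Sigma$-type with guard of the form $R(\bar s)$, $R(\bar t)\in D$, $\bar t\simeq\bar s$ and $\tau(\bar t)=\mathsf{type}_{D,\Sigma}(R(\bar t))$. * $\mathsf{lin}(\Sigma)$ is the set of the following linear TGDs. Let $\sigma\in\Sigma$ have guard $R(\bar u)$, head atoms $R_1(\bar u_1),\dots,R_m(\bar u_m)$ and existential variables $z_1,\dots,z_n$. Let $\tau$ be a $\Sigma$-type and $h$ a homomorphism from the body of $\sigma$ to $\mathsf{atoms}(\tau)$ with $h(R(\bar u))=\mathsf{guard}(\tau)$. The induced linear TGD is $$[\tau](\bar u)\to\exists z_1\cdots\exists z_n\,[\tau_1](\bar u_1),\dots,[\tau_m](\bar u_m).$$ Here $f(x)=h(x)$ for $x\in\mathsf{fr}(\sigma)$ and $f(z_i)=\mathsf{ar}(\Sigma)+i$; $\alpha_i=R_i(f(\bar u_i))$; $I=\{\alpha_1,\dots,\alpha_m\}\cup\mathsf{atoms}(\tau)$, regarded as a database whose constants are integers; $T_i=\{\beta\in\mathsf{complete}(I,\Sigma) : \mathsf{dom}(\beta)\subseteq\mathsf{dom}(\alpha_i)\}\setminus\{\alpha_i\}$;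 and $\tau_i=(\rho(\alpha_i),\rho(T_i))$, where $\rho$ renames the integers of $\alpha_i$ to $1,2,\dots$ in the order of their first occurrence in $\alpha_i$. **Proposition.** Let $\Sigma$ be a finite set of guarded TGDs and $D$ a database all of whose predicates belong to $\mathsf{sch}(\Sigma)$. Then: 1. $\Sigma\in\mathsf{CT}_D$ if and only if $\mathsf{lin}(\Sigma)\in\mathsf{CT}_{\mathsf{lin}(D)}$ (for each of the two readings of $\mathsf{CT}$, with every and with some valid derivation). 2. $\mathsf{maxdepth}(D,\Sigma)=\mathsf{maxdepth}(\mathsf{lin}(D),\mathsf{lin}(\Sigma))$. -/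

import Mathlib

universe u v w

namespace GuardedChase

/-- A relational signature: relation symbols, each with a positive arity. -/
structure Signature where
  Rel : Type u
  arity : Rel → ℕ
  arity_pos : ∀ R, 0 < arity R

/-- An atom `R(t₁,…,tₙ)` with arguments in `T` (variables, constants, integers, or terms). -/
@[ext]
structure Atom (S : Signature.{u}) (T : Type v) where
  rel : S.Rel
  args : Fin (S.arity rel) → T

namespace Atom

variable {S : Signature.{u}} {T : Type v} {T' : Type w}

/-- Application of a substitution to an atom. -/
def map (f : T → T') (a : Atom S T) : Atom S T' := ⟨a.rel, fun i => f (a.args i)⟩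

/-- The set of arguments occurring in an atom. -/
def dom (a : Atom S T) : Set T := Set.range a.args

end Atom

/-- The active domain of a set of atoms. -/
def adom {S : Signature.{u}} {T : Type v} (I : Set (Atom S T)) : Set T := {t | ∃ a ∈ I, t ∈ a.dom}

/-- The countably infinite set of variables. -/
abbrev Var : Type := ℕ

/-- The variables occurring in a list of atoms, listed from left to right with repetitions. -/
def varList {S : Signature.{u}} (l : List (Atom S Var)) : List Var :=
  l.flatMap fun a => List.ofFn a.args

/-- A (constant-free) tuple-generating dependency. The variables of the head that do not occur in
the body are the existentially quantified ones. -/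
structure TGD (S : Signature.{u}) where
  body : List (Atom S Var)
  head : List (Atom S Var)
  body_ne : body ≠ []
  head_ne : head ≠ []

namespace TGD

variable {S : Signature.{u}} (σ : TGD S)

def bodyVars : Finset Var := (varList σ.body).toFinset

def headVars : Finset Var := (varList σ.head).toFinset

/-- The frontier: the variables that occur both in the body and in the head. -/
def frontier : Finset Var := σ.bodyVars ∩ σ.headVars

/-- An enumeration without repetitions `z₁,…,zₙ` of the existentially quantified variables. -/
def exVars : List Var := ((varList σ.head).filter fun x => decide (x ∉ σ.bodyVars)).dedup

/-- The atom `a` contains all the variables of the body. -/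
def Covers (a : Atom S Var) : Prop := ∀ x ∈ σ.bodyVars, x ∈ a.dom

/-- Some atom of the body contains all the variables of the body. -/
def Guarded : Prop := ∃ a ∈ σ.body, σ.Covers a

open Classical in
/-- The guard: the leftmost atom of the body that contains all the variables of the body. (If the
dependency is not guarded, this is the first atom of the body, a value that is never used.) -/
noncomputable def guard : Atom S Var :=
  (σ.body.find? fun a => decide (σ.Covers a)).getD (σ.body.head σ.body_ne)

end TGD

/-- The terms of instances: constants from `C`, and the nulls `⊥_{σ,g}^z`, where `g` is a
substitution defined on the frontier of `σ`. -/
inductive Term (S : Signature.{u}) (C : Type v) : Type (max u v)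
  | const (c : C) : Term S C
  | null (σ : TGD S) (g : {x : Var // x ∈ σ.frontier} → Term S C) (z : Var) : Term S C

/-- The depth of a term. The supremum over an empty frontier is `0`. -/
def Term.depth {S : Signature.{u}} {C : Type v} : Term S C → ℕ
  | .const _ => 0
  | .null _ g _ => 1 + Finset.univ.sup fun x => (g x).depth

/-- Instances: possibly infinite sets of atoms over constants and nulls. -/
abbrev Inst (S : Signature.{u}) (C : Type v) := Set (Atom S (Term S C))

/-- A set of facts, seen as an instance. -/
def toInst {S : Signature.{u}} {C : Type v} (D : Set (Atom S C)) : Inst S C :=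
  Atom.map Term.const '' D

section Chase

variable {S : Signature.{u}} {C : Type v}

/-- `(σ, h)` is a trigger for `Γ` on `I`. Only the values of `h` on the variables of the body
of `σ` matter, here and below. -/
def IsTrigger (Γ : Set (TGD S)) (I : Inst S C) (σ : TGD S) (h : Var → Term S C) : Prop :=
  σ ∈ Γ ∧ ∀ a ∈ σ.body, a.map h ∈ I

/-- The substitution that instantiates the head: the frontier variables are mapped by `h`, and the
existentially quantified variable `z` is mapped to the null `⊥_{σ, h|fr(σ)}^z`. -/
def headSubst (σ : TGD S) (h : Var → Term S C) (x : Var) : Term S C :=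
  if x ∈ σ.frontier then h x else Term.null σ (fun y => h y.1) x

/-- The result of a trigger. -/
def result (σ : TGD S) (h : Var → Term S C) : Inst S C :=
  {b | ∃ a ∈ σ.head, b = a.map (headSubst σ h)}

def IsActive (Γ : Set (TGD S)) (I : Inst S C) (σ : TGD S) (h : Var → Term S C) : Prop :=
  IsTrigger Γ I σ h ∧ ¬ result σ h ⊆ I

/-- A (semi-oblivious) chase derivation `I₀, I₁, …` of `D` w.r.t. `Γ`, finite (of the form
`I₀,…,Iₙ` with `n = length`) or infinite (`length = ⊤`). The values `inst i` with `i > length`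
are irrelevant. -/
structure Derivation (D : Set (Atom S C)) (Γ : Set (TGD S)) where
  length : ℕ∞
  inst : ℕ → Inst S C
  start : inst 0 = toInst D
  step : ∀ i : ℕ, (i : ℕ∞) < length →
    ∃ σ h, IsActive Γ (inst i) σ h ∧ inst (i + 1) = inst i ∪ result σ h
  final : ∀ n : ℕ, length = n → ∀ σ h, ¬ IsActive Γ (inst n) σ h

namespace Derivation

variable {D : Set (Atom S C)} {Γ : Set (TGD S)}

def IsFinite (d : Derivation D Γ) : Prop := d.length ≠ ⊤

def Fair (d : Derivation D Γ) : Prop :=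
  ∀ i σ h, IsActive Γ (d.inst i) σ h → ∃ j > i, ¬ IsActive Γ (d.inst j) σ h

/-- Valid derivations are the finite ones and the infinite fair ones. -/
def Valid (d : Derivation D Γ) : Prop := d.IsFinite ∨ d.Fair

/-- The result of a derivation: the union of its instances (for a finite derivation, the last
instance, since derivations are increasing). -/
def result (d : Derivation D Γ) : Inst S C :=
  {a | ∃ i : ℕ, (i : ℕ∞) ≤ d.length ∧ a ∈ d.inst i}

end Derivation

/-- The sets of TGDs all of whose valid chase derivations from `D` are finite. -/
def CTForall (D : Set (Atom S C)) : Set (Set (TGD S)) :=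
  {Γ | ∀ d : Derivation D Γ, d.Valid → d.IsFinite}

/-- The sets of TGDs that have some finite valid chase derivation from `D`. -/
def CTExists (D : Set (Atom S C)) : Set (Set (TGD S)) :=
  {Γ | ∃ d : Derivation D Γ, d.Valid ∧ d.IsFinite}

/-- The instance `chase(D, Γ)`: the result of the valid chase derivations of `D` w.r.t. `Γ`. All of
them have the same result, see `result_eq_chase`. -/
def chase (D : Set (Atom S C)) (Γ : Set (TGD S)) : Inst S C :=
  {a | ∃ d : Derivation D Γ, d.Valid ∧ a ∈ d.result}

open Classical in
/-- The maximal depth over all terms of `chase(D, Γ)`; it is `∞` if `chase(D, Γ)` is infinite. -/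
noncomputable def maxdepth (D : Set (Atom S C)) (Γ : Set (TGD S)) : ℕ∞ :=
  if (chase D Γ).Finite then ⨆ t ∈ adom (chase D Γ), (t.depth : ℕ∞) else ⊤

namespace Derivation

variable {D : Set (Atom S C)} {Γ : Set (TGD S)}

theorem inst_mono (d : Derivation D Γ) {i j : ℕ} (hij : i ≤ j) (hj : (j : ℕ∞) ≤ d.length) :
    d.inst i ⊆ d.inst j := by
  induction j, hij using Nat.le_induction with
  | base => exact subset_rfl
  | succ j _ ih =>
    have hlt : (j : ℕ∞) < d.length :=
      lt_of_lt_of_le (by exact_mod_cast Nat.lt_succ_self j) hj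
    obtain ⟨σ, h, -, he⟩ := d.step j hlt
    rw [he]
    exact (ih hlt.le).trans Set.subset_union_left

theorem result_subset (d : Derivation D Γ) {J : Inst S C} (h0 : toInst D ⊆ J)
    (hJ : ∀ σ h, IsTrigger Γ J σ h → GuardedChase.result σ h ⊆ J) : d.result ⊆ J := by
  rintro a ⟨i, hi, ha⟩
  suffices H : d.inst i ⊆ J from H ha
  clear ha
  induction i with
  | zero => rw [d.start]; exact h0
  | succ i ih =>
    have hlt : (i : ℕ∞) < d.length :=
      lt_of_lt_of_le (by exact_mod_cast Nat.lt_succ_self i) hi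
    obtain ⟨σ, h, hact, he⟩ := d.step i hlt
    rw [he]
    have hs := ih hlt.le
    exact Set.union_subset hs (hJ σ h ⟨hact.1.1, fun b hb => hs (hact.1.2 b hb)⟩)

theorem result_closed (d : Derivation D Γ) (hv : d.Valid) (σ : TGD S) (h : Var → Term S C)
    (ht : IsTrigger Γ d.result σ h) : GuardedChase.result σ h ⊆ d.result := by
  have key : ∀ l : List (Atom S Var), (∀ a ∈ l, a.map h ∈ d.result) →
      ∃ i : ℕ, (i : ℕ∞) ≤ d.length ∧ ∀ a ∈ l, a.map h ∈ d.inst i := by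
    intro l
    induction l with
    | nil => intro _; exact ⟨0, by simp, by simp⟩
    | cons b l ih =>
      intro hl
      obtain ⟨i, hi, hi'⟩ := ih fun a ha => hl a (List.mem_cons_of_mem _ ha)
      obtain ⟨k, hk, hk'⟩ := hl b List.mem_cons_self
      have hm : ((max i k : ℕ) : ℕ∞) ≤ d.length := by
        rcases max_choice i k with e | e <;> rw [e] <;> assumption
      refine ⟨max i k, hm, fun a ha => ?_⟩
      rcases List.mem_cons.1 ha with rfl | ha
      · exact d.inst_mono (le_max_right _ _) hm hk'
      · exact d.inst_mono (le_max_left _ _) hm (hi' a ha)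
  obtain ⟨i, hi, hb⟩ := key σ.body ht.2
  rcases eq_or_ne d.length ⊤ with htop | hfin
  · have hle : ∀ j : ℕ, (j : ℕ∞) ≤ d.length := fun j => by rw [htop]; exact le_top
    by_cases hs : GuardedChase.result σ h ⊆ d.inst i
    · exact fun a ha => ⟨i, hi, hs ha⟩
    · obtain ⟨j, hj, hna⟩ := (hv.resolve_left fun hne => hne htop) i σ h ⟨⟨ht.1, hb⟩, hs⟩
      have hsub : GuardedChase.result σ h ⊆ d.inst j := by
        by_contra hcon
        exact hna ⟨⟨ht.1, fun a ha => d.inst_mono hj.le (hle j) (hb a ha)⟩, hcon⟩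
      exact fun a ha => ⟨j, hle j, hsub ha⟩
  · obtain ⟨n, hn⟩ := ENat.ne_top_iff_exists.1 hfin
    have hin : i ≤ n := by rw [← hn] at hi; exact_mod_cast hi
    have hsub : GuardedChase.result σ h ⊆ d.inst n := by
      by_contra hcon
      exact d.final n hn.symm σ h
        ⟨⟨ht.1, fun a ha => d.inst_mono hin hn.le (hb a ha)⟩, hcon⟩
    exact fun a ha => ⟨n, hn.le, hsub ha⟩

/-- Every valid derivation has the result `chase(D, Γ)`. -/
theorem result_eq_chase (d : Derivation D Γ) (hv : d.Valid) : d.result = chase D Γ := by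
  refine Set.Subset.antisymm (fun a ha => ⟨d, hv, ha⟩) ?_
  rintro a ⟨e, -, ha⟩
  have h0 : toInst D ⊆ d.result := fun b hb => ⟨0, by simp, by rw [d.start]; exact hb⟩
  exact e.result_subset h0 (d.result_closed hv) ha

end Derivation

/-- The type of the atom `α` w.r.t. `D` and `Γ`: the atoms of `chase(D, Γ)` that mention only terms
of `α`. -/
def typeOf (D : Set (Atom S C)) (Γ : Set (TGD S)) (α : Atom S (Term S C)) : Inst S C :=
  {β ∈ chase D Γ | β.dom ⊆ α.dom}

/-- The completion of `D` w.r.t. `Γ`: the atoms of `chase(D, Γ)` that mention only terms of `D`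
(which are constants). -/
def completion (D : Set (Atom S C)) (Γ : Set (TGD S)) : Set (Atom S C) :=
  {β | β.map Term.const ∈ chase D Γ ∧ β.dom ⊆ adom D}

end Chase

section Linearization

variable {S : Signature.{u}}

/-- The schema of a set of TGDs: the relation symbols that occur in it. -/
def sch (Γ : Set (TGD S)) : Set S.Rel :=
  {R | ∃ σ ∈ Γ, ∃ a : Atom S Var, (a ∈ σ.body ∨ a ∈ σ.head) ∧ a.rel = R}

/-- The maximal arity of a relation symbol of a (finite) set of TGDs. -/
noncomputable def maxArity (Γ : Set (TGD S)) : ℕ := sSup (S.arity '' sch Γ)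

/-- The atoms over the schema `P` and the set `V` of arguments. -/
def base {T : Type v} (P : Set S.Rel) (V : Set T) : Set (Atom S T) :=
  {a | a.rel ∈ P ∧ a.dom ⊆ V}

/-- Pairs `(α, T)` of an atom and a set of atoms over the integers. -/
structure Shape (S : Signature.{u}) where
  guard : Atom S ℕ
  rest : Set (Atom S ℕ)

namespace Shape

def atoms (τ : Shape S) : Set (Atom S ℕ) := insert τ.guard τ.rest

/-- `τ` is a `Γ`-type: its guard `R(t₁,…,tₙ)` satisfies `R ∈ sch(Γ)`, `t₁ = 1` and
`1 ≤ tᵢ ≤ max {t₁,…,tᵢ₋₁} + 1` (for `i = 1` the maximum is `0`, which gives `t₁ = 1`), and the rest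
consists of other atoms over the schema of `Γ` and the integers of the guard. -/
def IsType (Γ : Set (TGD S)) (τ : Shape S) : Prop :=
  τ.guard.rel ∈ sch Γ ∧
  (∀ i, 1 ≤ τ.guard.args i ∧ τ.guard.args i ≤ (Finset.Iio i).sup τ.guard.args + 1) ∧
  τ.rest ⊆ base (sch Γ) τ.guard.dom \ {τ.guard}

/-- The instantiation `τ(u)`: replace every `tᵢ` by `uᵢ` in the atoms of `τ`, where `t` is the tuple
of arguments of the guard (used only if `u` and `t` have the same equality pattern). -/
def instantiate {T : Type v} (τ : Shape S) (u : Fin (S.arity τ.guard.rel) → T) :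
    Set (Atom S T) :=
  {β | ∃ f : ℕ → T, (∀ i, f (τ.guard.args i) = u i) ∧ ∃ γ ∈ τ.atoms, β = γ.map f}

end Shape

/-- The relation `t ≃ u` for tuples of the same length: they have the same equality pattern. -/
def SamePattern {n : ℕ} {T : Type v} {U : Type w} (t : Fin n → T) (u : Fin n → U) : Prop :=
  ∀ i j, t i = t j ↔ u i = u j

/-- The signature of the new predicates `[τ]`, where `[τ]` has the arity of the guard of `τ`. -/
def linSig (S : Signature.{u}) : Signature.{u} where
  Rel := Shape S
  arity τ := S.arity τ.guard.rel
  arity_pos τ := S.arity_pos τ.guard.rel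

/-- The linearization of `D` w.r.t. `Γ`: the facts `[τ](t)` such that `τ` is a `Γ`-type with a guard
of the form `R(s)`, where `R(t) ∈ D`, `t ≃ s` and `τ(t)` is the type of `R(t)`. -/
def linDB {C : Type v} (Γ : Set (TGD S)) (D : Set (Atom S C)) : Set (Atom (linSig S) C) :=
  {b | ∃ (τ : Shape S) (t : Fin (S.arity τ.guard.rel) → C),
    (⟨τ.guard.rel, t⟩ : Atom S C) ∈ D ∧
    τ.IsType Γ ∧ SamePattern t τ.guard.args ∧
    τ.instantiate (fun i => (Term.const (t i) : Term S C)) =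
      typeOf D Γ ⟨τ.guard.rel, fun i => Term.const (t i)⟩ ∧
    b = ⟨τ, t⟩}

/-- The renaming `ρ` of the integers of a tuple `t` such that they appear in increasing order from
`1`: the integer `m` is mapped to `1` plus the number of distinct integers that occur in `t`
before the first occurrence of `m`. -/
def rho {n : ℕ} (t : Fin n → ℕ) (m : ℕ) : ℕ :=
  ((Finset.univ.filter fun j => ∀ i ≤ j, t i ≠ m).image t).card + 1

/-- The function `f` on the variables of the head of `σ`: frontier variables are mapped by `h`, and
the `i`-th existentially quantified variable is mapped to `ar(Γ) + i`. -/
noncomputable def headMap (Γ : Set (TGD S)) (σ : TGD S) (h : Var → ℕ) (x : Var) : ℕ :=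
  if x ∈ σ.frontier then h x else maxArity Γ + (σ.exVars.idxOf x + 1)

/-- The set `I` that consists of the images of the head atoms of `σ` and of the atoms of `τ`. -/
def childDB (Γ : Set (TGD S)) (σ : TGD S) (τ : Shape S) (h : Var → ℕ) : Set (Atom S ℕ) :=
  {b | ∃ a ∈ σ.head, b = a.map (headMap Γ σ h)} ∪ τ.atoms

/-- The shape `τᵢ` of the head atom `a = Rᵢ(uᵢ)` of `σ`: with `αᵢ = Rᵢ(f(uᵢ))` and `Tᵢ` the set of
the atoms other than `αᵢ` in the completion of `I` that mention only integers of `αᵢ`, it is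
`(ρ(αᵢ), ρ(Tᵢ))`. -/
noncomputable def childShape (Γ : Set (TGD S)) (σ : TGD S) (τ : Shape S) (h : Var → ℕ)
    (a : Atom S Var) : Shape S where
  guard := ⟨a.rel, fun i => rho (fun j => headMap Γ σ h (a.args j)) (headMap Γ σ h (a.args i))⟩
  rest := Atom.map (rho fun j => headMap Γ σ h (a.args j)) ''
    ({β ∈ completion (childDB Γ σ τ h) Γ | β.dom ⊆ (a.map (headMap Γ σ h)).dom} \
      {a.map (headMap Γ σ h)})

/-- The shape whose guard is the image under `h` of the guard of `σ`. -/
noncomputable def bodyShape (σ : TGD S) (h : Var → ℕ) (T : Set (Atom S ℕ)) : Shape S :=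
  ⟨σ.guard.map h, T⟩

/-- The linearization `[τ](u) → ∃ z₁ … zₙ [τ₁](u₁), …, [τₘ](uₘ)` of `σ` induced by the shape
`τ = (h(R(u)), T)` and `h`, where `R(u)` is the guard of `σ`. -/
noncomputable def linTGD (Γ : Set (TGD S)) (σ : TGD S) (h : Var → ℕ) (T : Set (Atom S ℕ)) :
    TGD (linSig S) where
  body := [⟨bodyShape σ h T, σ.guard.args⟩]
  head := σ.head.map fun a => ⟨childShape Γ σ (bodyShape σ h T) h a, a.args⟩
  body_ne := by simp
  head_ne := by simpa using σ.head_ne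

/-- The linearization of `Γ`: all the linearizations of a `σ ∈ Γ` induced by a `Γ`-type `τ` and a
homomorphism `h` from the body of `σ` to the atoms of `τ` that maps the guard of `σ` to that
of `τ`. -/
def linSet (Γ : Set (TGD S)) : Set (TGD (linSig S)) :=
  {σ' | ∃ σ ∈ Γ, ∃ (h : Var → ℕ) (T : Set (Atom S ℕ)),
    (bodyShape σ h T).IsType Γ ∧ (∀ a ∈ σ.body, a.map h ∈ (bodyShape σ h T).atoms) ∧
    σ' = linTGD Γ σ h T}

end Linearization

end GuardedChase

namespace GuardedChase

/-! The two chases contain terms of exactly the same depths, and this decides everything. Over a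
finite database and finitely many TGDs there are only finitely many well-formed terms below any
given depth, so a chase is finite iff its depths are bounded; and both readings of termination
amount to finiteness of the chase. `termination_congr` packages this.

The depths are compared through the relation `Represents` between an atom `[τ](t')` of the
linearized chase and an atom `R(t)` of the chase: same equality pattern, same depths position by
position, and `τ(t)` is the type of `R(t)`. Since a guarded body lives inside the type of its guard,
one atom carrying its type suffices to fire a rule; `Describes.represents_head` shows that firing a
rule and its linearization in parallel preserves the relation. Induction along either chase then
gives `exists_represented` and `exists_representing`.

The crux is `Describes.typeOf_head`: the type of a new head atom can be computed over integers from
the coded type of the guard. Decoding integers to terms is a homomorphism into the chase, which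
gives one inclusion. For the other, guardedness forces an atom that mentions a descendant of the
trigger to mention only descendants and frontier terms. Its derivation can therefore be replayed
over the coded database by collapsing frontier terms and new nulls to their integers
(`Describes.retract_mem_of_desc`). -/

/-! ### Atoms, substitutions and guards -/

theorem Atom.map_map {S : Signature.{u}} {T T' T'' : Type*} (f : T → T') (g : T' → T'')
    (a : Atom S T) : (a.map f).map g = a.map fun x => g (f x) := rfl

theorem Atom.map_congr {S : Signature.{u}} {T T' : Type*} {f g : T → T'} {a : Atom S T}
    (h : ∀ x ∈ a.dom, f x = g x) : a.map f = a.map g := by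
  simp only [Atom.map]
  congr 1
  funext i
  exact h _ ⟨i, rfl⟩

theorem Atom.map_eq_self {S : Signature.{u}} {T : Type*} {f : T → T} {a : Atom S T}
    (h : ∀ x ∈ a.dom, f x = x) : a.map f = a := Atom.map_congr (g := id) h

theorem Atom.dom_map {S : Signature.{u}} {T T' : Type*} (f : T → T') (a : Atom S T) :
    (a.map f).dom = f '' a.dom := by
  simp only [Atom.map, Atom.dom]
  exact Set.range_comp f a.args

theorem Atom.mem_dom_map {S : Signature.{u}} {T T' : Type*} {f : T → T'} {a : Atom S T} {x : T}
    (h : x ∈ a.dom) : f x ∈ (a.map f).dom := by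
  rw [Atom.dom_map]; exact ⟨x, h, rfl⟩

theorem Atom.map_injOn {S : Signature.{u}} {T T' : Type*} {f : T → T'} {V : Set T}
    (hf : Set.InjOn f V) {a b : Atom S T} (ha : a.dom ⊆ V) (hb : b.dom ⊆ V)
    (h : a.map f = b.map f) : a = b := by
  obtain ⟨R, s⟩ := a
  obtain ⟨R', s'⟩ := b
  simp only [Atom.map, Atom.mk.injEq] at h
  obtain ⟨rfl, h⟩ := h
  congr 1
  funext i
  exact hf (ha ⟨i, rfl⟩) (hb ⟨i, rfl⟩) (congrFun (eq_of_heq h) i)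

theorem base_finite {S : Signature.{u}} {T : Type v} {P : Set S.Rel} {V : Set T}
    (hP : P.Finite) (hV : V.Finite) : (base P V).Finite := by
  refine (hP.biUnion (t := fun R => (fun s => (⟨R, s⟩ : Atom S T)) '' {s | ∀ i, s i ∈ V})
    fun R _ => (Set.Finite.pi' fun _ => hV).image _).subset ?_
  rintro ⟨R, s⟩ ⟨hR, hs⟩
  exact Set.mem_biUnion hR ⟨s, fun i => hs ⟨i, rfl⟩, rfl⟩

theorem adom_finite {S : Signature.{u}} {T : Type v} {D : Set (Atom S T)} (hD : D.Finite) :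
    (adom D).Finite := by
  refine (hD.biUnion (t := fun a => a.dom) fun a _ => Set.finite_range _).subset ?_
  rintro t ⟨a, ha, ht⟩
  exact Set.mem_biUnion ha ht

theorem mem_varList {S : Signature.{u}} {l : List (Atom S Var)} {x : Var} :
    x ∈ varList l ↔ ∃ a ∈ l, x ∈ a.dom := by
  simp [varList, Atom.dom, List.mem_ofFn]

namespace TGD

variable {S : Signature.{u}} {σ : TGD S}

theorem mem_bodyVars {x : Var} : x ∈ σ.bodyVars ↔ ∃ a ∈ σ.body, x ∈ a.dom := by
  simp [bodyVars, mem_varList]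

theorem mem_headVars {x : Var} : x ∈ σ.headVars ↔ ∃ a ∈ σ.head, x ∈ a.dom := by
  simp [headVars, mem_varList]

theorem mem_frontier {x : Var} : x ∈ σ.frontier ↔ x ∈ σ.bodyVars ∧ x ∈ σ.headVars := by
  simp [frontier]

theorem guard_spec (h : σ.Guarded) : σ.guard ∈ σ.body ∧ σ.Covers σ.guard := by
  classical
  unfold guard
  cases hf : σ.body.find? fun a => decide (σ.Covers a) with
  | none =>
    obtain ⟨a, ha, hc⟩ := h
    have := List.find?_eq_none.1 hf a ha
    simp [hc] at this
  | some a =>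
    exact ⟨by simpa using List.mem_of_find?_eq_some hf, by simpa using List.find?_some hf⟩

theorem mem_bodyVars_iff_guard (h : σ.Guarded) {x : Var} :
    x ∈ σ.bodyVars ↔ ∃ i, σ.guard.args i = x :=
  ⟨fun hx => (guard_spec h).2 x hx, fun hx => mem_bodyVars.2 ⟨_, (guard_spec h).1, hx⟩⟩

end TGD

/-! ### The chase as a least closed instance; termination as finiteness -/

section Chase

variable {S : Signature.{u}} {C : Type v} {D : Set (Atom S C)} {Γ : Set (TGD S)}

/-- The relation symbols of a set of facts and of a set of TGDs. -/
def relsOf (D : Set (Atom S C)) (Γ : Set (TGD S)) : Set S.Rel := Atom.rel '' D ∪ sch Γ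

theorem sch_finite (hΓ : Γ.Finite) : (sch Γ).Finite := by
  refine (hΓ.biUnion (t := fun σ => Atom.rel '' {a | a ∈ σ.body} ∪ Atom.rel '' {a | a ∈ σ.head})
    fun σ _ => ((List.finite_toSet _).image _).union ((List.finite_toSet _).image _)).subset ?_
  rintro R ⟨σ, hσ, a, ha | ha, rfl⟩
  · exact Set.mem_biUnion hσ (Or.inl ⟨a, ha, rfl⟩)
  · exact Set.mem_biUnion hσ (Or.inr ⟨a, ha, rfl⟩)

theorem relsOf_finite (hD : D.Finite) (hΓ : Γ.Finite) : (relsOf D Γ).Finite :=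
  (hD.image _).union (sch_finite hΓ)

/-- The terms built from constants of `K` and the existential variables of TGDs of `Γ`. -/
inductive Term.Wf (K : Set C) (Γ : Set (TGD S)) : Term S C → Prop
  | const (c : C) : c ∈ K → Term.Wf K Γ (.const c)
  | null (σ : TGD S) (g : {x : Var // x ∈ σ.frontier} → Term S C) (z : Var) : σ ∈ Γ →
      z ∈ σ.headVars → (∀ x, Term.Wf K Γ (g x)) → Term.Wf K Γ (.null σ g z)

theorem depth_lt_depth_null (σ : TGD S) (g : {x : Var // x ∈ σ.frontier} → Term S C) (z : Var)
    (x : {x : Var // x ∈ σ.frontier}) : (g x).depth < (Term.null σ g z).depth := by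
  have := Finset.le_sup (f := fun x => (g x).depth) (Finset.mem_univ x)
  simp only [Term.depth]
  omega

/-- Induction on the depth: a null is determined by its TGD, its variable and its frontier terms,
which are strictly less deep. -/
theorem wf_finite {K : Set C} (hK : K.Finite) (hΓ : Γ.Finite) (k : ℕ) :
    {t : Term S C | t.Wf K Γ ∧ t.depth < k}.Finite := by
  induction k with
  | zero => simp
  | succ k ih =>
    refine ((hK.image Term.const).union (hΓ.biUnion (t := fun σ =>
      ⋃ z ∈ σ.headVars, (fun g => Term.null σ g z) '' {g | ∀ x, g x ∈
        {t : Term S C | t.Wf K Γ ∧ t.depth < k}}) fun σ _ => ?_)).subset ?_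
    · exact σ.headVars.finite_toSet.biUnion fun z _ => (Set.Finite.pi' fun _ => ih).image _
    · rintro t ⟨ht, hk⟩
      cases ht with
      | const c hc => exact Or.inl ⟨c, hc, rfl⟩
      | null σ g z hσ hz hg =>
        refine Or.inr (Set.mem_biUnion hσ (Set.mem_biUnion hz ⟨g, fun x => ⟨hg x, ?_⟩, rfl⟩))
        have := depth_lt_depth_null σ g z x
        omega

/-- The maximal depth of the frontier terms of a trigger. -/
def triggerRank (σ : TGD S) (h : Var → Term S C) : ℕ := σ.frontier.sup fun x => (h x).depth

theorem depth_headSubst_le (σ : TGD S) (h : Var → Term S C) (x : Var) :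
    (headSubst σ h x).depth ≤ triggerRank σ h + 1 := by
  unfold headSubst triggerRank
  split_ifs with hx
  · exact (Finset.le_sup (f := fun x => (h x).depth) hx).trans (Nat.le_succ _)
  · simp only [Term.depth]
    have : (Finset.univ.sup fun x : {x : Var // x ∈ σ.frontier} => (h x.1).depth) ≤
        σ.frontier.sup fun x => (h x).depth :=
      Finset.sup_le fun y _ => Finset.le_sup (f := fun x => (h x).depth) y.2
    omega

theorem wf_headSubst {K : Set C} {σ : TGD S} (hσ : σ ∈ Γ) {h : Var → Term S C}
    (hh : ∀ x ∈ σ.bodyVars, (h x).Wf K Γ) {x : Var} (hx : x ∈ σ.headVars) :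
    (headSubst σ h x).Wf K Γ := by
  unfold headSubst
  split_ifs with hf
  · exact hh x (TGD.mem_frontier.1 hf).1
  · exact .null _ _ _ hσ hx fun y => hh _ (TGD.mem_frontier.1 y.2).1

theorem IsTrigger.mem_dom {I : Inst S C} {σ : TGD S} {h : Var → Term S C}
    (ht : IsTrigger Γ I σ h) {x : Var} (hx : x ∈ σ.bodyVars) : ∃ a ∈ I, h x ∈ a.dom := by
  obtain ⟨a, ha, hxa⟩ := TGD.mem_bodyVars.1 hx
  exact ⟨_, ht.2 a ha, Atom.mem_dom_map hxa⟩

theorem result_subset_wf {I : Inst S C} (K : Set C) (P : Set S.Rel) (hP : sch Γ ⊆ P)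
    (hI : I ⊆ base P {t | t.Wf K Γ}) {σ : TGD S}
    {h : Var → Term S C} (ht : IsTrigger Γ I σ h) :
    result σ h ⊆ base P {t | t.Wf K Γ ∧ t.depth < triggerRank σ h + 2} := by
  rintro _ ⟨a, ha, rfl⟩
  refine ⟨hP ⟨σ, ht.1, a, Or.inr ha, rfl⟩, ?_⟩
  rw [Atom.dom_map]
  rintro _ ⟨x, hx, rfl⟩
  refine ⟨wf_headSubst ht.1 (fun y hy => ?_) (TGD.mem_headVars.2 ⟨a, ha, hx⟩),
    Nat.lt_succ_of_le (depth_headSubst_le σ h x)⟩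
  obtain ⟨b, hb, hyb⟩ := ht.mem_dom hy
  exact (hI hb).2 hyb

theorem exists_active_min {I : Inst S C} (H : ∃ σ h, IsActive Γ I σ h) :
    ∃ p : TGD S × (Var → Term S C), IsActive Γ I p.1 p.2 ∧
      ∀ σ h, IsActive Γ I σ h → triggerRank p.1 p.2 ≤ triggerRank σ h := by
  classical
  have H' : ∃ n, ∃ σ h, IsActive Γ I σ h ∧ triggerRank σ h = n := by
    obtain ⟨σ, h, hh⟩ := H
    exact ⟨_, σ, h, hh, rfl⟩
  obtain ⟨σ, h, hh, he⟩ := Nat.find_spec H'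
  exact ⟨(σ, h), hh, fun σ' h' hh' => he ▸ Nat.find_min' H' ⟨σ', h', hh', rfl⟩⟩

open Classical in
/-- Apply an active trigger of minimal rank, if there is an active trigger. -/
noncomputable def chaseStep (Γ : Set (TGD S)) (I : Inst S C) : Inst S C :=
  if H : ∃ σ h, IsActive Γ I σ h then
    I ∪ result (exists_active_min H).choose.1 (exists_active_min H).choose.2
  else I

theorem chaseStep_spec {I : Inst S C} (H : ∃ σ h, IsActive Γ I σ h) :
    ∃ σ h, IsActive Γ I σ h ∧ (∀ σ' h', IsActive Γ I σ' h' → triggerRank σ h ≤ triggerRank σ' h') ∧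
      chaseStep Γ I = I ∪ result σ h :=
  ⟨_, _, (exists_active_min H).choose_spec.1, (exists_active_min H).choose_spec.2, by
    rw [chaseStep, dif_pos H]⟩

theorem chaseStep_iterate_subset (n : ℕ) :
    (chaseStep Γ)^[n] (toInst D) ⊆ base (relsOf D Γ) {t | t.Wf (adom D) Γ} := by
  induction n with
  | zero =>
    rintro _ ⟨a, ha, rfl⟩
    refine ⟨Or.inl ⟨a, ha, rfl⟩, ?_⟩
    rw [Atom.dom_map]
    rintro _ ⟨c, hc, rfl⟩
    exact .const _ ⟨a, ha, hc⟩
  | succ n ih =>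
    rw [Function.iterate_succ_apply']
    by_cases H : ∃ σ h, IsActive Γ ((chaseStep Γ)^[n] (toInst D)) σ h
    · obtain ⟨σ, h, ha, -, he⟩ := chaseStep_spec H
      rw [he]
      refine Set.union_subset ih
        ((result_subset_wf _ _ Set.subset_union_right ih ha.1).trans ?_)
      exact fun a ha => ⟨ha.1, fun t ht => (ha.2 ht).1⟩
    · rw [chaseStep, dif_neg H]
      exact ih

/-- Firing active triggers of minimal rank is fair. If a trigger stayed active forever, every later
step would have at most its rank and would add a new atom to a fixed finite set of atoms of bounded
depth. -/
theorem exists_valid (hD : D.Finite) (hΓ : Γ.Finite) : ∃ d : Derivation D Γ, d.Valid := by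
  classical
  set I : ℕ → Inst S C := fun n => (chaseStep Γ)^[n] (toInst D) with hI
  have hsucc : ∀ n, I (n + 1) = chaseStep Γ (I n) := fun n => Function.iterate_succ_apply' _ _ _
  by_cases H : ∃ n, ¬ ∃ σ h, IsActive Γ (I n) σ h
  · refine ⟨⟨Nat.find H, I, rfl, fun i hi => ?_, fun n hn σ h hh => ?_⟩, Or.inl ?_⟩
    · have := Nat.find_min H (by exact_mod_cast hi : i < Nat.find H)
      obtain ⟨σ, h, ha, -, he⟩ := chaseStep_spec (not_not.1 this)
      exact ⟨σ, h, ha, by rw [hsucc, he]⟩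
    · have hn' : Nat.find H = n := by exact_mod_cast hn
      exact (hn' ▸ Nat.find_spec H) ⟨σ, h, hh⟩
    · exact ENat.natCast_ne_top _
  · push Not at H
    refine ⟨⟨⊤, I, rfl, fun i _ => ?_, fun n hn => absurd hn (ENat.top_ne_natCast n)⟩, Or.inr ?_⟩
    · obtain ⟨σ, h, ha, -, he⟩ := chaseStep_spec (H i)
      exact ⟨σ, h, ha, by rw [hsucc, he]⟩
    · intro i σ h ha
      by_contra! hcon
      change ∀ j > i, IsActive Γ (I j) σ h at hcon
      change IsActive Γ (I i) σ h at ha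
      -- A trigger of rank `r` creates terms of depth at most `r + 1`; the bound is strict, hence `+
      -- 2`.
      set F := base (relsOf D Γ) {t : Term S C | t.Wf (adom D) Γ ∧ t.depth < triggerRank σ h + 2}
      have hF : F.Finite := base_finite (relsOf_finite hD hΓ) (wf_finite (adom_finite hD) hΓ _)
      have hact : ∀ j, IsActive Γ (I (i + j)) σ h := fun j => by
        rcases Nat.eq_zero_or_pos j with rfl | hj
        · exact ha
        · exact hcon _ (by omega)
      have hmono : StrictMono fun j => (I (i + j) ∩ F).ncard := by
        refine strictMono_nat_of_lt_succ fun j => ?_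
        obtain ⟨σ', h', ha', hmin, he⟩ := chaseStep_spec (H (i + j))
        rw [← hsucc] at he
        refine Set.ncard_lt_ncard ?_ (hF.subset Set.inter_subset_right)
        have hsub : result σ' h' ⊆ F := by
          refine (result_subset_wf _ _ Set.subset_union_right
            (chaseStep_iterate_subset (i + j)) ha'.1).trans ?_
          refine fun b hb => ⟨hb.1, fun t ht => ⟨(hb.2 ht).1, (hb.2 ht).2.trans_le ?_⟩⟩
          exact Nat.add_le_add_right (hmin σ h (hact j)) 2
        obtain ⟨b, hb, hb'⟩ := Set.not_subset.1 ha'.2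
        rw [← Nat.add_assoc, he]
        refine Set.ssubset_iff_of_subset
          (Set.inter_subset_inter_left _ Set.subset_union_left) |>.2 ?_
        exact ⟨b, ⟨Or.inr hb, hsub hb⟩, fun hh => hb' hh.1⟩
      have h1 := hmono.le_apply (x := F.ncard + 1)
      have h2 := Set.ncard_le_ncard (Set.inter_subset_right (s := I (i + (F.ncard + 1)))) hF
      omega

theorem toInst_subset_chase (hD : D.Finite) (hΓ : Γ.Finite) : toInst D ⊆ chase D Γ := by
  obtain ⟨d, hd⟩ := exists_valid hD hΓ
  exact fun a ha => ⟨d, hd, 0, by simp, by rwa [d.start]⟩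

theorem chase_closed (hD : D.Finite) (hΓ : Γ.Finite) {σ : TGD S} {h : Var → Term S C}
    (ht : IsTrigger Γ (chase D Γ) σ h) : result σ h ⊆ chase D Γ := by
  obtain ⟨d, hd⟩ := exists_valid hD hΓ
  rw [← d.result_eq_chase hd] at ht ⊢
  exact d.result_closed hd σ h ht

/-- Together with `toInst_subset_chase` and `chase_closed`, this characterizes the chase as the
least instance that contains the database and the results of all its triggers. The comparison of the
two chases uses only this. -/
theorem chase_subset {J : Inst S C} (h0 : toInst D ⊆ J)
    (hJ : ∀ σ h, IsTrigger Γ J σ h → result σ h ⊆ J) : chase D Γ ⊆ J := by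
  rintro a ⟨d, -, ha⟩
  exact d.result_subset h0 hJ ha

/-- Induction along the chase. -/
theorem chase_induction (hD : D.Finite) (hΓ : Γ.Finite) {p : Atom S (Term S C) → Prop}
    (h0 : ∀ a ∈ D, p (a.map Term.const))
    (h1 : ∀ σ h, IsTrigger Γ (chase D Γ) σ h → (∀ b ∈ σ.body, p (b.map h)) →
      ∀ a ∈ σ.head, p (a.map (headSubst σ h))) {a : Atom S (Term S C)} (ha : a ∈ chase D Γ) :
    p a := by
  -- Membership in the chase is kept in the invariant, so that the induction step may use that the
  -- trigger is one on the chase.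
  refine (chase_subset (J := {a ∈ chase D Γ | p a}) ?_ ?_ ha).2
  · rintro _ ⟨b, hb, rfl⟩
    exact ⟨toInst_subset_chase hD hΓ ⟨b, hb, rfl⟩, h0 b hb⟩
  · intro σ h ht
    have ht' : IsTrigger Γ (chase D Γ) σ h := ⟨ht.1, fun b hb => (ht.2 b hb).1⟩
    intro b hb
    refine ⟨chase_closed hD hΓ ht' hb, ?_⟩
    obtain ⟨a, ha, rfl⟩ := hb
    exact h1 σ h ht' (fun b hb => (ht.2 b hb).2) a ha

theorem chase_subset_base : chase D Γ ⊆ base (relsOf D Γ) {t | t.Wf (adom D) Γ} := by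
  refine chase_subset (chaseStep_iterate_subset 0) fun σ h ht => ?_
  exact (result_subset_wf _ _ Set.subset_union_right subset_rfl ht).trans
    fun a ha => ⟨ha.1, fun t ht => (ha.2 ht).1⟩

theorem chase_finite_of_depth_lt (hD : D.Finite) (hΓ : Γ.Finite) {k : ℕ}
    (hk : ∀ t ∈ adom (chase D Γ), t.depth < k) : (chase D Γ).Finite :=
  (base_finite (relsOf_finite hD hΓ) (wf_finite (adom_finite hD) hΓ k)).subset fun a ha =>
    ⟨(chase_subset_base ha).1, fun _ ht => ⟨(chase_subset_base ha).2 ht, hk _ ⟨a, ha, ht⟩⟩⟩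

theorem exists_depth_lt (h : (chase D Γ).Finite) : ∃ k, ∀ t ∈ adom (chase D Γ), t.depth < k := by
  obtain ⟨k, hk⟩ := ((adom_finite h).image Term.depth).bddAbove
  exact ⟨k + 1, fun t ht => Nat.lt_succ_of_le (hk ⟨t, ht, rfl⟩)⟩

theorem result_finite (σ : TGD S) (h : Var → Term S C) : (result σ h).Finite := by
  refine ((List.finite_toSet σ.head).image fun a => a.map (headSubst σ h)).subset ?_
  rintro _ ⟨a, ha, rfl⟩
  exact ⟨a, ha, rfl⟩

theorem Derivation.inst_finite (hD : D.Finite) (d : Derivation D Γ) (n : ℕ)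
    (hn : (n : ℕ∞) ≤ d.length) : (d.inst n).Finite := by
  induction n with
  | zero => rw [d.start]; exact hD.image _
  | succ n ih =>
    have hlt : (n : ℕ∞) < d.length :=
      lt_of_lt_of_le (by exact_mod_cast Nat.lt_succ_self n) hn
    obtain ⟨σ, h, -, he⟩ := d.step n hlt
    rw [he]
    exact (ih hlt.le).union (result_finite σ h)

theorem chase_finite_of_ctExists (hD : D.Finite) (h : Γ ∈ CTExists D) : (chase D Γ).Finite := by
  obtain ⟨d, hv, hf⟩ := h
  obtain ⟨n, hn⟩ := ENat.ne_top_iff_exists.1 hf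
  rw [← d.result_eq_chase hv]
  refine (d.inst_finite hD n hn.le).subset ?_
  rintro a ⟨i, hi, ha⟩
  exact d.inst_mono (by rw [← hn] at hi; exact_mod_cast hi) hn.le ha

/-- Each step adds an atom, so an infinite derivation would have instances of unbounded size inside
a finite result. -/
theorem ctForall_of_chase_finite (h : (chase D Γ).Finite) : Γ ∈ CTForall D := by
  intro d hv htop
  rw [← d.result_eq_chase hv] at h
  have hle : ∀ n : ℕ, (n : ℕ∞) ≤ d.length := fun n => htop ▸ le_top
  have hsub : ∀ n, d.inst n ⊆ d.result := fun n a ha => ⟨n, hle n, ha⟩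
  have hmono : StrictMono fun n => (d.inst n).ncard := by
    refine strictMono_nat_of_lt_succ fun n => Set.ncard_lt_ncard ?_ (h.subset (hsub _))
    obtain ⟨σ, g, ha, he⟩ := d.step n (htop ▸ ENat.natCast_lt_top n)
    obtain ⟨b, hb, hb'⟩ := Set.not_subset.1 ha.2
    rw [he]
    exact Set.ssubset_iff_of_subset Set.subset_union_left |>.2 ⟨b, Or.inr hb, hb'⟩
  have h1 := hmono.le_apply (x := d.result.ncard + 1)
  have h2 := Set.ncard_le_ncard (hsub (d.result.ncard + 1)) h
  omega

theorem ctExists_of_ctForall (hD : D.Finite) (hΓ : Γ.Finite) (h : Γ ∈ CTForall D) :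
    Γ ∈ CTExists D := by
  obtain ⟨d, hd⟩ := exists_valid hD hΓ
  exact ⟨d, hd, h d hd⟩

theorem mem_ctForall_iff (hD : D.Finite) (hΓ : Γ.Finite) :
    Γ ∈ CTForall D ↔ (chase D Γ).Finite :=
  ⟨fun h => chase_finite_of_ctExists hD (ctExists_of_ctForall hD hΓ h), ctForall_of_chase_finite⟩

theorem mem_ctExists_iff (hD : D.Finite) (hΓ : Γ.Finite) :
    Γ ∈ CTExists D ↔ (chase D Γ).Finite :=
  ⟨chase_finite_of_ctExists hD, fun h => ctExists_of_ctForall hD hΓ (ctForall_of_chase_finite h)⟩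

end Chase

/-- If the chases of two finite sets of facts w.r.t. finite sets of TGDs have terms of the same
depths, then they have the same termination properties and maximal depths. -/
theorem termination_congr {S : Signature.{u}} {S' : Signature.{w}} {C : Type v}
    {D : Set (Atom S C)} {Γ : Set (TGD S)} {D' : Set (Atom S' C)} {Γ' : Set (TGD S')}
    (hD : D.Finite) (hΓ : Γ.Finite) (hD' : D'.Finite) (hΓ' : Γ'.Finite)
    (h1 : ∀ t ∈ adom (chase D Γ), ∃ t' ∈ adom (chase D' Γ'), t'.depth = t.depth)
    (h2 : ∀ t' ∈ adom (chase D' Γ'), ∃ t ∈ adom (chase D Γ), t.depth = t'.depth) :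
    (Γ ∈ CTForall D ↔ Γ' ∈ CTForall D') ∧ (Γ ∈ CTExists D ↔ Γ' ∈ CTExists D') ∧
      maxdepth D Γ = maxdepth D' Γ' := by
  have key : (chase D Γ).Finite ↔ (chase D' Γ').Finite := by
    constructor
    · intro h
      obtain ⟨k, hk⟩ := exists_depth_lt h
      refine chase_finite_of_depth_lt hD' hΓ' (k := k) fun t' ht' => ?_
      obtain ⟨t, ht, he⟩ := h2 t' ht'
      exact he ▸ hk t ht
    · intro h
      obtain ⟨k, hk⟩ := exists_depth_lt h
      refine chase_finite_of_depth_lt hD hΓ (k := k) fun t ht => ?_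
      obtain ⟨t', ht', he⟩ := h1 t ht
      exact he ▸ hk t' ht'
  refine ⟨?_, ?_, ?_⟩
  · rw [mem_ctForall_iff hD hΓ, mem_ctForall_iff hD' hΓ', key]
  · rw [mem_ctExists_iff hD hΓ, mem_ctExists_iff hD' hΓ', key]
  · unfold maxdepth
    by_cases hf : (chase D Γ).Finite
    · rw [if_pos hf, if_pos (key.1 hf)]
      apply le_antisymm
      · refine iSup₂_le fun t ht => ?_
        obtain ⟨t', ht', he⟩ := h1 t ht
        rw [← he]
        exact le_iSup₂ (f := fun (t : Term S' C) (_ : t ∈ adom (chase D' Γ')) =>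
          (t.depth : ℕ∞)) t' ht'
      · refine iSup₂_le fun t' ht' => ?_
        obtain ⟨t, ht, he⟩ := h2 t' ht'
        rw [← he]
        exact le_iSup₂ (f := fun (t : Term S C) (_ : t ∈ adom (chase D Γ)) =>
          (t.depth : ℕ∞)) t ht
    · rw [if_neg hf, if_neg fun h => hf (key.2 h)]

/-! ### The canonical renaming of the integers of a tuple -/

/-- The positions before the first occurrence of a value form an initial segment, so two such
segments are nested. If they contain equally many distinct values they contain the same values; then
neither value can first occur strictly before the other, and both occur first at the same position.
-/
theorem rho_injOn {n : ℕ} (t : Fin n → ℕ) : Set.InjOn (rho t) (Set.range t) := by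
  set L : ℕ → Finset (Fin n) := fun m => Finset.univ.filter fun j => ∀ i ≤ j, t i ≠ m with hL
  have key : ∀ m m', (∃ i, t i = m) → L m ⊆ L m' → rho t m = rho t m' → m = m' := by
    intro m m' hm hsub he
    have hcard : (L m').image t = (L m).image t := by
      refine (Finset.eq_of_subset_of_card_le (Finset.image_subset_image hsub) ?_).symm
      exact (Nat.add_right_cancel he).ge
    have hne : ∀ m j, j ∈ L m → t j ≠ m := fun m j hj => (Finset.mem_filter.1 hj).2 j le_rfl
    have h1 : ∀ i, t i = m → ∃ k ≤ i, t k = m' := by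
      intro i hi
      by_contra! hcon
      have : t i ∈ (L m').image t :=
        Finset.mem_image_of_mem _ (Finset.mem_filter.2 ⟨Finset.mem_univ _, hcon⟩)
      rw [hcard] at this
      obtain ⟨j, hj, hj'⟩ := Finset.mem_image.1 this
      exact hne m j hj (hj'.trans hi)
    have h2 : ∀ i, t i = m' → ∃ k ≤ i, t k = m := by
      intro i hi
      by_contra! hcon
      exact hne m' i (hsub (Finset.mem_filter.2 ⟨Finset.mem_univ _, hcon⟩)) hi
    obtain ⟨i, hi, hmin⟩ := WellFounded.has_min (wellFounded_lt (α := Fin n)) {i | t i = m} hm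
    obtain ⟨k, hk, hk'⟩ := h1 i hi
    obtain ⟨l, hl, hl'⟩ := h2 k hk'
    have : ¬ l < i := hmin l hl'
    have hki : k = i := le_antisymm hk (le_trans (not_lt.1 this) hl)
    rw [← hi, ← hk', hki]
  rintro _ ⟨i, rfl⟩ _ ⟨k, rfl⟩ he
  have hnest : L (t i) ⊆ L (t k) ∨ L (t k) ⊆ L (t i) := by
    by_contra! hcon
    obtain ⟨j, hj, hj'⟩ := Finset.not_subset.1 hcon.1
    obtain ⟨l, hl, hl'⟩ := Finset.not_subset.1 hcon.2
    simp only [hL, Finset.mem_filter, Finset.mem_univ, true_and, not_forall, not_not] at hj hj' hl hl'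
    obtain ⟨a, ha, ha'⟩ := hj'
    obtain ⟨b, hb, hb'⟩ := hl'
    rcases le_total j l with h | h
    · exact hl a (ha.trans h) ha'
    · exact hj b (hb.trans h) hb'
  rcases hnest with h | h
  · exact key _ _ ⟨i, rfl⟩ h he
  · exact (key _ _ ⟨k, rfl⟩ h he.symm).symm

/-- The values before the first occurrence of `t i` all occur at positions below `i`. Their new
names are distinct and lie between `1` and the supremum, so there are at most that many of them. -/
theorem rho_le_sup {n : ℕ} (t : Fin n → ℕ) (i : Fin n) :
    rho t (t i) ≤ (Finset.Iio i).sup (fun j => rho t (t j)) + 1 := by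
  set s := (Finset.Iio i).sup fun j => rho t (t j) with hs
  refine Nat.add_le_add_right ?_ 1
  calc ((Finset.univ.filter fun j => ∀ k ≤ j, t k ≠ t i).image t).card
      ≤ ((Finset.Iio i).image t).card := by
        refine Finset.card_le_card (Finset.image_subset_image fun j hj => ?_)
        rw [Finset.mem_Iio]
        by_contra! hcon
        exact (Finset.mem_filter.1 hj).2 i hcon rfl
    _ = (((Finset.Iio i).image t).image (rho t)).card := by
        refine (Finset.card_image_of_injOn ((rho_injOn t).mono ?_)).symm
        intro m hm
        obtain ⟨j, -, rfl⟩ := Finset.mem_image.1 hm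
        exact ⟨j, rfl⟩
    _ ≤ (Finset.Icc 1 s).card := by
        refine Finset.card_le_card fun m hm => ?_
        obtain ⟨_, hm', rfl⟩ := Finset.mem_image.1 hm
        obtain ⟨j, hj, rfl⟩ := Finset.mem_image.1 hm'
        exact Finset.mem_Icc.2 ⟨Nat.le_add_left _ _,
          Finset.le_sup (f := fun j => rho t (t j)) hj⟩
    _ = s := by simp

/-! ### Finiteness of the linearization; equality patterns -/

section

variable {S : Signature.{u}} {Γ : Set (TGD S)}

theorem arity_le_maxArity (hΓ : Γ.Finite) {R : S.Rel} (hR : R ∈ sch Γ) :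
    S.arity R ≤ maxArity Γ :=
  le_csSup ((sch_finite hΓ).image _).bddAbove ⟨R, hR, rfl⟩

namespace Shape.IsType

variable {τ : Shape S}

/-- The growth condition bounds the entry at position `i`, counted from `0`, by `i + 1`. Hence the
integers above `maxArity Γ`, which `headMap` gives to existential variables, never collide with
those of a type. -/
theorem args_le (hΓ : Γ.Finite) (h : τ.IsType Γ) (i : Fin (S.arity τ.guard.rel)) :
    τ.guard.args i ≤ maxArity Γ := by
  have key : ∀ m, ∀ i : Fin (S.arity τ.guard.rel), i.1 = m → τ.guard.args i ≤ m + 1 := by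
    intro m
    induction m using Nat.strong_induction_on with
    | _ m ih =>
      rintro i rfl
      refine (h.2.1 i).2.trans (Nat.add_le_add_right (Finset.sup_le fun j hj => ?_) 1)
      have hj' : j < i := Finset.mem_Iio.1 hj
      exact (ih j.1 hj' j rfl).trans hj'
  have := key i.1 i rfl
  have := i.2
  have := arity_le_maxArity hΓ h.1
  omega

theorem guard_mem_base (h : τ.IsType Γ) : τ.guard ∈ base (sch Γ) τ.guard.dom := ⟨h.1, subset_rfl⟩

theorem atoms_subset (h : τ.IsType Γ) : τ.atoms ⊆ base (sch Γ) τ.guard.dom :=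
  Set.insert_subset h.guard_mem_base fun _ hb => (h.2.2 hb).1

theorem atoms_finite (hΓ : Γ.Finite) (h : τ.IsType Γ) : τ.atoms.Finite :=
  (base_finite (sch_finite hΓ) (Set.finite_range _)).subset h.atoms_subset

end Shape.IsType

theorem isType_finite (hΓ : Γ.Finite) : {τ : Shape S | τ.IsType Γ}.Finite := by
  have hB : (base (S := S) (sch Γ) (Set.Iic (maxArity Γ))).Finite :=
    base_finite (sch_finite hΓ) (Set.finite_Iic _)
  refine ((hB.prod hB.finite_subsets).image fun p => ⟨p.1, p.2⟩).subset ?_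
  intro τ h
  have hdom : τ.guard.dom ⊆ Set.Iic (maxArity Γ) := by
    rintro _ ⟨i, rfl⟩
    exact h.args_le hΓ i
  exact ⟨(τ.guard, τ.rest), ⟨⟨h.1, hdom⟩, fun b hb => ⟨(h.2.2 hb).1.1, (h.2.2 hb).1.2.trans hdom⟩⟩,
    rfl⟩

theorem linDB_finite {C : Type v} {D : Set (Atom S C)} (hD : D.Finite) (hΓ : Γ.Finite) :
    (linDB Γ D).Finite := by
  refine (base_finite (S := linSig S) (P := {τ : Shape S | τ.IsType Γ}) (isType_finite hΓ)
    (adom_finite hD)).subset ?_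
  rintro _ ⟨τ, t, ht, hτ, -, -, rfl⟩
  refine ⟨hτ, ?_⟩
  rintro _ ⟨i, rfl⟩
  exact ⟨_, ht, i, rfl⟩

theorem headMap_congr {σ : TGD S} {h h' : Var → ℕ} (hh : ∀ x ∈ σ.frontier, h x = h' x) :
    headMap Γ σ h = headMap Γ σ h' := by
  funext x
  unfold headMap
  split_ifs with hx
  · exact hh x hx
  · rfl

/-- The homomorphism ranges over infinitely many functions on variables, but by guardedness its
values on the frontier are fixed by the shape. This makes `linSet` finite. -/
theorem linTGD_congr {σ : TGD S} (hσ : σ.Guarded) {h h' : Var → ℕ} {T T' : Set (Atom S ℕ)}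
    (he : bodyShape σ h T = bodyShape σ h' T') : linTGD Γ σ h T = linTGD Γ σ h' T' := by
  have hg : σ.guard.map h = σ.guard.map h' := congrArg Shape.guard he
  have hh : ∀ x ∈ σ.frontier, h x = h' x := by
    intro x hx
    obtain ⟨i, rfl⟩ := (TGD.mem_bodyVars_iff_guard hσ).1 (TGD.mem_frontier.1 hx).1
    simp only [Atom.map, Atom.mk.injEq, heq_eq_eq, true_and] at hg
    exact congrFun hg i
  have hT : T = T' := congrArg Shape.rest he
  subst hT
  have hargs : (fun i => h (σ.guard.args i)) = fun i => h' (σ.guard.args i) := by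
    simpa only [Atom.map, Atom.mk.injEq, heq_eq_eq, true_and] using hg
  have hguard : (⟨bodyShape σ h T, σ.guard.args⟩ : Atom (linSig S) Var) =
      ⟨bodyShape σ h' T, σ.guard.args⟩ :=
    congrArg (fun A => (⟨⟨⟨σ.guard.rel, A⟩, T⟩, σ.guard.args⟩ : Atom (linSig S) Var)) hargs
  have hhead : ∀ a : Atom S Var,
      (⟨childShape Γ σ (bodyShape σ h T) h a, a.args⟩ : Atom (linSig S) Var) =
      ⟨childShape Γ σ (bodyShape σ h' T) h' a, a.args⟩ := fun a =>
    congrArg₂ (fun (f : Var → ℕ) (τ : Shape S) =>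
      (⟨⟨⟨a.rel, fun i => rho (fun j => f (a.args j)) (f (a.args i))⟩,
        Atom.map (rho fun j => f (a.args j)) ''
          ({β ∈ completion ({b | ∃ a ∈ σ.head, b = a.map f} ∪ τ.atoms) Γ |
            β.dom ⊆ (a.map f).dom} \ {a.map f})⟩, a.args⟩ : Atom (linSig S) Var))
      (headMap_congr hh) he
  unfold linTGD
  simp only [hguard, hhead]

theorem linSet_finite (hΓ : Γ.Finite) (hG : ∀ σ ∈ Γ, σ.Guarded) : (linSet Γ).Finite := by
  refine (hΓ.biUnion (t := fun σ => ⋃ τ ∈ {τ : Shape S | τ.IsType Γ},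
    {σ' | ∃ h T, bodyShape σ h T = τ ∧ σ' = linTGD Γ σ h T}) fun σ hσ =>
      (isType_finite hΓ).biUnion fun τ _ => Set.Subsingleton.finite ?_).subset ?_
  · rintro _ ⟨h, T, he, rfl⟩ _ ⟨h', T', he', rfl⟩
    exact linTGD_congr (hG σ hσ) (he.trans he'.symm)
  · rintro _ ⟨σ, hσ, h, T, hτ, -, rfl⟩
    exact Set.mem_biUnion hσ (Set.mem_biUnion hτ ⟨h, T, rfl, rfl⟩)

theorem mem_bodyVars_linTGD {σ : TGD S} (hσ : σ.Guarded) {h : Var → ℕ} {T : Set (Atom S ℕ)}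
    {x : Var} : x ∈ (linTGD Γ σ h T).bodyVars ↔ x ∈ σ.bodyVars := by
  rw [TGD.mem_bodyVars, TGD.mem_bodyVars_iff_guard hσ]
  simp only [linTGD, List.mem_singleton, exists_eq_left]
  rfl

theorem mem_headVars_linTGD {σ : TGD S} {h : Var → ℕ} {T : Set (Atom S ℕ)}
    {x : Var} : x ∈ (linTGD Γ σ h T).headVars ↔ x ∈ σ.headVars := by
  rw [TGD.mem_headVars, TGD.mem_headVars]
  simp only [linTGD, List.mem_map, exists_exists_and_eq_and]
  rfl

/-- The guard alone already has all the body variables, and the head keeps its argument tuples. This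
is why nulls of the two chases have equal depths. -/
theorem frontier_linTGD {σ : TGD S} (hσ : σ.Guarded) {h : Var → ℕ} {T : Set (Atom S ℕ)} :
    (linTGD Γ σ h T).frontier = σ.frontier := by
  ext x
  rw [TGD.mem_frontier, TGD.mem_frontier, mem_bodyVars_linTGD hσ, mem_headVars_linTGD]

theorem mem_exVars {σ : TGD S} {x : Var} (hx : x ∈ σ.headVars) (hx' : x ∉ σ.frontier) :
    x ∈ σ.exVars := by
  have hb : x ∉ σ.bodyVars := fun hb => hx' (TGD.mem_frontier.2 ⟨hb, hx⟩)
  simp only [TGD.headVars, List.mem_toFinset] at hx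
  simp [TGD.exVars, hx, hb]

theorem apply_ne_null {S : Signature.{u}} {C : Type v} {σ : TGD S} (h : Var → Term S C) {x : Var}
    (hx : x ∈ σ.frontier) (z : Var) : h x ≠ Term.null σ (fun y => h y.1) z := by
  intro he
  have := depth_lt_depth_null σ (fun y => h y.1) z ⟨x, hx⟩
  rw [← he] at this
  exact lt_irrefl _ this

/-- The instantiated head of a trigger and its encoding by integers have the same equalities. -/
theorem headSubst_eq_iff {S' : Signature.{w}} {C : Type v} {σ : TGD S} {σ' : TGD S'}
    (hfr : σ'.frontier = σ.frontier) {h : Var → Term S' C} {k : Var → ℕ}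
    (hpat : ∀ x ∈ σ.frontier, ∀ y ∈ σ.frontier, (h x = h y ↔ k x = k y))
    (hk : ∀ x ∈ σ.frontier, k x ≤ maxArity Γ) {x y : Var} (hx : x ∈ σ.headVars) :
    headSubst σ' h x = headSubst σ' h y ↔ headMap Γ σ k x = headMap Γ σ k y := by
  unfold headSubst headMap
  by_cases hxf : x ∈ σ.frontier <;> by_cases hyf : y ∈ σ.frontier <;>
    simp only [hfr, hxf, hyf, if_true, if_false]
  · exact hpat x hxf y hyf
  · have := hk x hxf
    exact iff_of_false (apply_ne_null h (hfr ▸ hxf) y) (by omega)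
  · have := hk y hyf
    exact iff_of_false (apply_ne_null h (hfr ▸ hyf) x).symm (by omega)
  · simp only [Term.null.injEq, heq_eq_eq, true_and]
    -- Two nulls of one trigger differ only in their variable, and positions in `exVars` separate
    -- variables.
    rw [← List.idxOf_inj (mem_exVars hx hxf)]
    constructor <;> intro <;> omega

/-- The definition ranges over all maps with prescribed values on the guard; these agree on every
atom of the type, so any single one will do. -/
theorem instantiate_eq_image {T : Type v} {τ : Shape S} (hτ : τ.atoms ⊆ base (sch Γ) τ.guard.dom)
    {u : Fin (S.arity τ.guard.rel) → T} {f : ℕ → T} (hf : ∀ i, f (τ.guard.args i) = u i) :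
    τ.instantiate u = Atom.map f '' τ.atoms := by
  ext β
  constructor
  · rintro ⟨f', hf', γ, hγ, rfl⟩
    refine ⟨γ, hγ, Atom.map_congr fun x hx => ?_⟩
    obtain ⟨i, rfl⟩ := (hτ hγ).2 hx
    rw [hf, hf']
  · rintro ⟨γ, hγ, rfl⟩
    exact ⟨f, hf, γ, hγ, rfl⟩

theorem exists_fun_of_imp {ι : Type*} {T : Type v} {U : Type w} [Nonempty U] {t : ι → T}
    {u : ι → U} (h : ∀ i j, t i = t j → u i = u j) : ∃ f : T → U, ∀ i, f (t i) = u i := by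
  classical
  refine ⟨fun x => if hx : ∃ i, t i = x then u hx.choose else Classical.arbitrary U, fun i => ?_⟩
  have hx : ∃ j, t j = t i := ⟨i, rfl⟩
  simp only [dif_pos hx]
  exact h _ _ hx.choose_spec

theorem SamePattern.trans {n : ℕ} {T : Type*} {U : Type*} {V : Type*} {t : Fin n → T}
    {u : Fin n → U} {s : Fin n → V} (h : SamePattern t u) (h' : SamePattern u s) :
    SamePattern t s := fun i j => (h i j).trans (h' i j)

end

/-! ### Homomorphisms between chases: decoding constants and collapsing terms -/

section Lift

variable {S : Signature.{u}} {C : Type v} {C' : Type w} {Γ : Set (TGD S)}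

/-- The extension to nulls of a map that is defined on constants. -/
def Term.lift (m : C → Term S C') : Term S C → Term S C'
  | .const c => m c
  | .null σ g z => .null σ (fun x => (g x).lift m) z

theorem lift_headSubst (m : C → Term S C') (σ : TGD S) (h : Var → Term S C) (x : Var) :
    (headSubst σ h x).lift m = headSubst σ (fun y => (h y).lift m) x := by
  unfold headSubst
  split_ifs
  · rfl
  · simp only [Term.lift]

/-- A map on constants, possibly sending them to nulls, extends through nulls and commutes with
instantiating heads. It therefore carries the whole chase into any closed instance that contains the
image of the database. -/
theorem chase_lift {D : Set (Atom S C)} {J : Inst S C'} {m : C → Term S C'}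
    (h0 : ∀ a ∈ D, a.map m ∈ J) (hJ : ∀ σ h, IsTrigger Γ J σ h → result σ h ⊆ J)
    {a : Atom S (Term S C)} (ha : a ∈ chase D Γ) : a.map (Term.lift m) ∈ J := by
  refine chase_subset (J := {a | a.map (Term.lift m) ∈ J}) ?_ ?_ ha
  · rintro _ ⟨b, hb, rfl⟩
    exact h0 b hb
  · rintro σ h ht _ ⟨b, hb, rfl⟩
    refine hJ σ (fun x => (h x).lift m) ⟨ht.1, fun c hc => ht.2 c hc⟩ ⟨b, hb, ?_⟩
    rw [Atom.map_map]
    exact Atom.map_congr fun x _ => lift_headSubst m σ h x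

end Lift

section Retract

variable {S : Signature.{u}} {C : Type v}

/-- The term has a subterm of the form `⊥_{σ,h|fr(σ)}^z`. -/
def Term.Desc (σ : TGD S) (h : Var → Term S C) : Term S C → Prop
  | .const _ => False
  | .null σ' g z => Term.null σ' g z = Term.null σ (fun y => h y.1) z ∨ ∃ x, (g x).Desc σ h

theorem Term.Desc.depth_lt {σ : TGD S} {h : Var → Term S C} {t : Term S C} (ht : t.Desc σ h)
    {x : Var} (hx : x ∈ σ.frontier) : (h x).depth < t.depth := by
  induction t with
  | const c => exact ht.elim
  | null σ' g z ih =>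
    rcases ht with ht | ⟨y, hy⟩
    · rw [ht]
      exact depth_lt_depth_null σ (fun y => h y.1) z ⟨x, hx⟩
    · exact (ih y hy).trans (depth_lt_depth_null σ' g z y)

/-- Descendants are strictly deeper than every frontier term, so the frontier test in `Term.retract`
never stops at one of them. -/
theorem Term.Desc.ne {σ : TGD S} {h : Var → Term S C} {t : Term S C} (ht : t.Desc σ h)
    {x : Var} (hx : x ∈ σ.frontier) : h x ≠ t := by
  rintro rfl
  exact lt_irrefl _ (ht.depth_lt hx)

open Classical in
/-- The frontier terms of a trigger and the new nulls of its result are replaced by integers,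
inside of nulls as well. -/
noncomputable def Term.retract (Γ : Set (TGD S)) (σ : TGD S) (h : Var → Term S C) (k : Var → ℕ) :
    Term S C → Term S ℕ
  -- The value `0` is junk: in the atoms that matter, the constants met outside of collapsed terms
  -- are frontier terms.
  | .const c => if hx : ∃ x ∈ σ.frontier, h x = .const c then .const (k hx.choose) else .const 0
  | .null σ' g z =>
    if hx : ∃ x ∈ σ.frontier, h x = .null σ' g z then .const (k hx.choose)
    else if Term.null σ' g z = Term.null σ (fun y => h y.1) z then .const (headMap Γ σ k z)
    else .null σ' (fun y => (g y).retract Γ σ h k) z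

variable {Γ : Set (TGD S)} {σ : TGD S} {h : Var → Term S C} {k : Var → ℕ}

/-- Several frontier variables may share the term, but by the pattern hypothesis they share their
integer, so the chosen witness is harmless. -/
theorem retract_frontier
    (hpat : ∀ x ∈ σ.frontier, ∀ y ∈ σ.frontier, (h x = h y ↔ k x = k y)) {x : Var}
    (hx : x ∈ σ.frontier) : (h x).retract Γ σ h k = .const (k x) := by
  have key : ∀ t, t = h x → t.retract Γ σ h k = .const (k x) := by
    intro t ht
    have H : ∃ x ∈ σ.frontier, h x = t := ⟨x, hx, ht.symm⟩
    have hk : k H.choose = k x :=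
      (hpat _ H.choose_spec.1 x hx).1 (H.choose_spec.2.trans ht)
    cases t with
    | const c => rw [Term.retract, dif_pos H, hk]
    | null σ' g z => rw [Term.retract, dif_pos H, hk]
  exact key _ rfl

theorem retract_new (z : Var) :
    (Term.null σ (fun y => h y.1) z).retract Γ σ h k = .const (headMap Γ σ k z) := by
  rw [Term.retract, dif_neg, if_pos rfl]
  rintro ⟨x, hx, he⟩
  exact apply_ne_null h hx z he

theorem retract_headSubst
    (hpat : ∀ x ∈ σ.frontier, ∀ y ∈ σ.frontier, (h x = h y ↔ k x = k y)) (x : Var) :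
    (headSubst σ h x).retract Γ σ h k = .const (headMap Γ σ k x) := by
  unfold headSubst
  split_ifs with hx
  · rw [retract_frontier hpat hx, headMap, if_pos hx]
  · exact retract_new x

theorem retract_desc {σ' : TGD S} {g : {x : Var // x ∈ σ'.frontier} → Term S C} {z : Var}
    (hd : (Term.null σ' g z).Desc σ h)
    (hne : Term.null σ' g z ≠ Term.null σ (fun y => h y.1) z) :
    (Term.null σ' g z).retract Γ σ h k = .null σ' (fun y => (g y).retract Γ σ h k) z := by
  rw [Term.retract, dif_neg, if_neg hne]
  rintro ⟨x, hx, he⟩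
  exact hd.ne hx he

end Retract

/-! ### The type of a head atom, computed from the coded trigger -/

section ChildType

variable {S : Signature.{u}} {C : Type v} {D : Set (Atom S C)} {Γ : Set (TGD S)} {σ : TGD S}
  {h : Var → Term S C} {k : Var → ℕ} {T : Set (Atom S ℕ)}

/-- The trigger `(σ, h)` of `chase(D, Γ)` is described by a homomorphism `k` from the body of `σ` to
the atoms of the type `(k(guard(σ)), T)`. -/
structure Describes (D : Set (Atom S C)) (Γ : Set (TGD S)) (σ : TGD S) (h : Var → Term S C)
    (k : Var → ℕ) (T : Set (Atom S ℕ)) : Prop where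
  trigger : IsTrigger Γ (chase D Γ) σ h
  isType : (bodyShape σ k T).IsType Γ
  pattern : ∀ x ∈ σ.bodyVars, ∀ y ∈ σ.bodyVars, (h x = h y ↔ k x = k y)
  inst : (bodyShape σ k T).instantiate (fun i => h (σ.guard.args i)) = typeOf D Γ (σ.guard.map h)

namespace Describes

theorem frontier_pattern (H : Describes D Γ σ h k T) :
    ∀ x ∈ σ.frontier, ∀ y ∈ σ.frontier, (h x = h y ↔ k x = k y) := fun x hx y hy =>
  H.pattern x (TGD.mem_frontier.1 hx).1 y (TGD.mem_frontier.1 hy).1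

theorem bodyVars_le (hΓ : Γ.Finite) (hG : ∀ σ ∈ Γ, σ.Guarded) (H : Describes D Γ σ h k T)
    {x : Var} (hx : x ∈ σ.bodyVars) : k x ≤ maxArity Γ := by
  obtain ⟨i, rfl⟩ := (TGD.mem_bodyVars_iff_guard (hG σ H.trigger.1)).1 hx
  exact H.isType.args_le hΓ i

theorem headSubst_mem (hD : D.Finite) (hΓ : Γ.Finite) (H : Describes D Γ σ h k T)
    {a : Atom S Var} (ha : a ∈ σ.head) : a.map (headSubst σ h) ∈ chase D Γ :=
  chase_closed hD hΓ H.trigger ⟨a, ha, rfl⟩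

theorem childDB_finite (hΓ : Γ.Finite) (hτ : (bodyShape σ k T).IsType Γ) :
    (childDB Γ σ (bodyShape σ k T) k).Finite := by
  refine (((List.finite_toSet σ.head).image fun a => a.map (headMap Γ σ k)).subset ?_).union
    (hτ.atoms_finite hΓ)
  rintro _ ⟨a, ha, rfl⟩
  exact ⟨a, ha, rfl⟩

/-- A map from the integers of the encoded trigger to the terms that they stand for. -/
theorem exists_decode (hΓ : Γ.Finite) (hG : ∀ σ ∈ Γ, σ.Guarded) (H : Describes D Γ σ h k T) :
    ∃ m : ℕ → Term S C, (∀ x ∈ σ.bodyVars, m (k x) = h x) ∧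
      ∀ x ∈ σ.headVars, m (headMap Γ σ k x) = headSubst σ h x := by
  classical
  -- Integers of body variables decode through `h`; any other `n` is read as the null of the
  -- existential variable with index `n - maxArity Γ - 1`, which inverts `headMap`.
  refine ⟨fun n => if hn : ∃ x ∈ σ.bodyVars, k x = n then h hn.choose else
    Term.null σ (fun y => h y.1) (σ.exVars.getD (n - maxArity Γ - 1) 0), ?_⟩
  have h1 : ∀ x ∈ σ.bodyVars, ∀ hn : ∃ y ∈ σ.bodyVars, k y = k x, h hn.choose = h x :=
    fun x hx hn => (H.pattern _ hn.choose_spec.1 x hx).2 hn.choose_spec.2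
  refine ⟨fun x hx => ?_, fun x hx => ?_⟩
  · have hn : ∃ y ∈ σ.bodyVars, k y = k x := ⟨x, hx, rfl⟩
    simp only [dif_pos hn, h1 x hx hn]
  · unfold headMap headSubst
    by_cases hf : x ∈ σ.frontier
    · have hb := (TGD.mem_frontier.1 hf).1
      have hn : ∃ y ∈ σ.bodyVars, k y = k x := ⟨x, hb, rfl⟩
      simp only [if_pos hf, dif_pos hn, h1 x hb hn]
    · have hn : ¬ ∃ y ∈ σ.bodyVars, k y = maxArity Γ + (σ.exVars.idxOf x + 1) := by
        rintro ⟨y, hy, he⟩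
        have := H.bodyVars_le hΓ hG hy
        omega
      have he : maxArity Γ + (σ.exVars.idxOf x + 1) - maxArity Γ - 1 = σ.exVars.idxOf x := by omega
      have hlt := List.idxOf_lt_length_of_mem (mem_exVars hx hf)
      simp only [if_neg hf, dif_neg hn, he]
      rw [List.getD_eq_getElem _ _ hlt, List.getElem_idxOf]

/-- Soundness: the decoding sends both parts of the coded database into the chase, namely the head
atoms to the result of the trigger and the atoms of the type to the type of the guard. -/
theorem decode_mem (hD : D.Finite) (hΓ : Γ.Finite) (H : Describes D Γ σ h k T)
    {m : ℕ → Term S C} (hm : ∀ i, m (k (σ.guard.args i)) = h (σ.guard.args i))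
    (hm' : ∀ x ∈ σ.headVars, m (headMap Γ σ k x) = headSubst σ h x) {γ : Atom S ℕ}
    (hγ : γ ∈ completion (childDB Γ σ (bodyShape σ k T) k) Γ) : γ.map m ∈ chase D Γ := by
  refine chase_lift (m := m) ?_ (fun σ h ht => chase_closed hD hΓ ht) hγ.1
  rintro _ (⟨a, ha, rfl⟩ | hb)
  · rw [Atom.map_map]
    have := H.headSubst_mem hD hΓ ha
    rwa [Atom.map_congr (g := headSubst σ h)]
    exact fun x hx => hm' x (TGD.mem_headVars.2 ⟨a, ha, hx⟩)
  · have : Atom.map m _ ∈ (bodyShape σ k T).instantiate fun i => h (σ.guard.args i) :=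
      ⟨m, hm, _, hb, rfl⟩
    rw [H.inst] at this
    exact this.1

/-- Such an atom lies in the type of the guard, so a coded copy of it is already in the coded
database. -/
theorem retract_mem_of_frontier (hΓ : Γ.Finite) (hG : ∀ σ ∈ Γ, σ.Guarded)
    (H : Describes D Γ σ h k T) {β : Atom S (Term S C)} (hβ : β ∈ chase D Γ)
    (hdom : ∀ t ∈ β.dom, ∃ x ∈ σ.frontier, h x = t) :
    β.map (Term.retract Γ σ h k) ∈ chase (childDB Γ σ (bodyShape σ k T) k) Γ := by
  have hg := fun x => TGD.mem_bodyVars_iff_guard (hG σ H.trigger.1) (x := x)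
  have hmem : β ∈ typeOf D Γ (σ.guard.map h) := by
    refine ⟨hβ, fun t ht => ?_⟩
    obtain ⟨x, hx, rfl⟩ := hdom t ht
    obtain ⟨i, rfl⟩ := (hg x).1 (TGD.mem_frontier.1 hx).1
    exact ⟨i, rfl⟩
  rw [← H.inst] at hmem
  obtain ⟨f, hf, γ, hγ, rfl⟩ := hmem
  refine toInst_subset_chase (childDB_finite hΓ H.isType) hΓ ⟨γ, Or.inr hγ, ?_⟩
  rw [Atom.map_map]
  refine Atom.map_congr fun n hn => ?_
  obtain ⟨x, hx, he⟩ := hdom (f n) (Atom.mem_dom_map hn)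
  rw [← he, retract_frontier H.frontier_pattern hx]
  obtain ⟨i, rfl⟩ := (H.isType.atoms_subset hγ).2 hn
  have hfi : f (k (σ.guard.args i)) = h (σ.guard.args i) := hf i
  have : h x = h (σ.guard.args i) := he.trans hfi
  congr 1
  exact ((H.pattern x (TGD.mem_frontier.1 hx).1 _ ((hg _).2 ⟨i, rfl⟩)).1 this).symm

/-- An atom that mentions a null which descends from a trigger mentions otherwise only frontier
terms of this trigger, and it is derived from the result of the trigger and the atoms over the
frontier terms. -/
theorem retract_mem_of_desc (hD : D.Finite) (hΓ : Γ.Finite) (hG : ∀ σ ∈ Γ, σ.Guarded)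
    (H : Describes D Γ σ h k T) {β : Atom S (Term S C)} (hβ : β ∈ chase D Γ)
    (hdesc : ∃ t ∈ β.dom, t.Desc σ h) :
    (∀ t ∈ β.dom, t.Desc σ h ∨ ∃ x ∈ σ.frontier, h x = t) ∧
      β.map (Term.retract Γ σ h k) ∈ chase (childDB Γ σ (bodyShape σ k T) k) Γ := by
  have hfin := childDB_finite hΓ H.isType (k := k)
  revert hdesc
  refine chase_induction hD hΓ (p := fun β => (∃ t ∈ β.dom, t.Desc σ h) →
    (∀ t ∈ β.dom, t.Desc σ h ∨ ∃ x ∈ σ.frontier, h x = t) ∧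
      β.map (Term.retract Γ σ h k) ∈ chase (childDB Γ σ (bodyShape σ k T) k) Γ) ?_ ?_ hβ
  · rintro a - ⟨t, ht, hd⟩
    rw [Atom.dom_map] at ht
    obtain ⟨c, -, rfl⟩ := ht
    exact hd.elim
  · intro σ' h' ht ih a ha hdesc
    rw [Atom.dom_map] at hdesc ⊢
    -- If the trigger agrees with `(σ, h)` on the frontier it has the same result, whose coded head
    -- atoms are in the database. Otherwise the nulls it creates are at most proper descendants.
    by_cases hcase : ∃ z, Term.null σ' (fun y => h' y.1) z = Term.null σ (fun y => h y.1) z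
    · obtain ⟨z, hz⟩ := hcase
      simp only [Term.null.injEq] at hz
      obtain ⟨rfl, hz, -⟩ := hz
      have hfr : headSubst σ' h' = headSubst σ' h := by
        funext x
        unfold headSubst
        split_ifs with hx
        · exact congrFun (eq_of_heq hz) ⟨x, hx⟩
        · rw [eq_of_heq hz]
      rw [hfr]
      constructor
      · rintro _ ⟨x, -, rfl⟩
        unfold headSubst
        split_ifs with hx
        · exact Or.inr ⟨x, hx, rfl⟩
        · exact Or.inl (Or.inl rfl)
      · refine toInst_subset_chase hfin hΓ ⟨_, Or.inl ⟨a, ha, rfl⟩, ?_⟩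
        rw [Atom.map_map, Atom.map_map]
        exact Atom.map_congr fun x _ => (retract_headSubst H.frontier_pattern x).symm
    · push Not at hcase
      -- A descendant in the new atom now comes from a frontier term of the trigger.
      obtain ⟨y, hy, hyd⟩ : ∃ y ∈ σ'.frontier, (h' y).Desc σ h := by
        obtain ⟨_, ⟨x, -, rfl⟩, hd⟩ := hdesc
        unfold headSubst at hd
        split_ifs at hd with hx
        · exact ⟨x, hx, hd⟩
        · rcases hd with hd | ⟨y, hd⟩
          · exact absurd hd (hcase x)
          · exact ⟨y.1, y.2, hd⟩
      have hg := TGD.guard_spec (hG σ' ht.1)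
      -- Guardedness enters here: the guard contains that descendant, so the induction hypothesis
      -- for the guard controls all the body terms.
      have hall : ∀ x ∈ σ'.bodyVars, (h' x).Desc σ h ∨ ∃ z ∈ σ.frontier, h z = h' x := by
        intro x hx
        refine (ih _ hg.1 ⟨h' y, Atom.mem_dom_map (hg.2 y (TGD.mem_frontier.1 hy).1), hyd⟩).1 _
          (Atom.mem_dom_map (hg.2 x hx))
      have hnew : ∀ z, (Term.null σ' (fun y => h' y.1) z).Desc σ h := fun z =>
        Or.inr ⟨⟨y, hy⟩, hyd⟩
      refine ⟨?_, ?_⟩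
      · rintro _ ⟨x, -, rfl⟩
        unfold headSubst
        split_ifs with hx
        · exact hall x (TGD.mem_frontier.1 hx).1
        · exact Or.inl (hnew x)
      · have htr : IsTrigger Γ (chase (childDB Γ σ (bodyShape σ k T) k) Γ) σ'
            (fun x => (h' x).retract Γ σ h k) := by
          refine ⟨ht.1, fun b hb => ?_⟩
          rw [← Atom.map_map]
          -- Side atoms with a descendant are covered by induction; the others mention only frontier
          -- terms of `(σ, h)`.
          by_cases hbd : ∃ t ∈ (b.map h').dom, t.Desc σ h
          · exact (ih b hb hbd).2
          · refine H.retract_mem_of_frontier hΓ hG (ht.2 b hb) fun t hbt => ?_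
            have hnd : ¬ t.Desc σ h := fun hd => hbd ⟨t, hbt, hd⟩
            rw [Atom.dom_map] at hbt
            obtain ⟨x, hx, rfl⟩ := hbt
            exact (hall x (TGD.mem_bodyVars.2 ⟨b, hb, hx⟩)).resolve_left hnd
        refine chase_closed hfin hΓ htr ⟨a, ha, ?_⟩
        rw [Atom.map_map]
        refine Atom.map_congr fun x _ => ?_
        unfold headSubst
        split_ifs with hx
        · rfl
        · exact retract_desc (hnew x) (hcase x)

theorem desc_headSubst_or (x : Var) :
    (headSubst σ h x).Desc σ h ∨ ∃ y ∈ σ.frontier, h y = headSubst σ h x := by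
  unfold headSubst
  split_ifs with hx
  · exact Or.inr ⟨x, hx, rfl⟩
  · exact Or.inl (Or.inl rfl)

/-- The type of an atom in the result of a trigger is computed from the encoded trigger. -/
theorem typeOf_head (hD : D.Finite) (hΓ : Γ.Finite) (hG : ∀ σ ∈ Γ, σ.Guarded)
    (H : Describes D Γ σ h k T)
    {m : ℕ → Term S C} (hm : ∀ i, m (k (σ.guard.args i)) = h (σ.guard.args i))
    (hm' : ∀ x ∈ σ.headVars, m (headMap Γ σ k x) = headSubst σ h x)
    {a : Atom S Var} (ha : a ∈ σ.head) :
    typeOf D Γ (a.map (headSubst σ h)) = Atom.map m ''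
      {γ ∈ completion (childDB Γ σ (bodyShape σ k T) k) Γ |
        γ.dom ⊆ (a.map (headMap Γ σ k)).dom} := by
  have hav : ∀ x ∈ a.dom, x ∈ σ.headVars := fun x hx => TGD.mem_headVars.2 ⟨a, ha, hx⟩
  ext β
  constructor
  · rintro ⟨hβ, hdom⟩
    have hret : β.map (Term.retract Γ σ h k) ∈ chase (childDB Γ σ (bodyShape σ k T) k) Γ := by
      by_cases hd : ∃ t ∈ β.dom, t.Desc σ h
      · exact (H.retract_mem_of_desc hD hΓ hG hβ hd).2
      · refine H.retract_mem_of_frontier hΓ hG hβ fun t ht => ?_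
        have := hdom ht
        rw [Atom.dom_map] at this
        obtain ⟨x, hx, rfl⟩ := this
        exact (desc_headSubst_or x).resolve_left fun hd' => hd ⟨_, ht, hd'⟩
    -- Writing each argument as the instance of a head variable turns the collapsed atom into a
    -- coded atom whose decoding is `β`.
    have hex : ∀ i, ∃ x ∈ a.dom, headSubst σ h x = β.args i := by
      intro i
      have := hdom ⟨i, rfl⟩
      rw [Atom.dom_map] at this
      exact this
    choose x hxa hx using hex
    have hβe : β = Atom.mk β.rel fun i => headSubst σ h (x i) := by
      ext1
      · rfl
      · exact heq_of_eq (funext fun i => (hx i).symm)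
    have hγdom : (Atom.mk β.rel fun i => headMap Γ σ k (x i)).dom ⊆
        (a.map (headMap Γ σ k)).dom := by
      rintro _ ⟨i, rfl⟩
      exact Atom.mem_dom_map (hxa i)
    refine ⟨⟨β.rel, fun i => headMap Γ σ k (x i)⟩, ⟨⟨?_, ?_⟩, hγdom⟩, ?_⟩
    · rw [hβe] at hret
      have he : (Atom.mk β.rel fun i => headSubst σ h (x i)).map (Term.retract Γ σ h k) =
          (Atom.mk β.rel fun i => headMap Γ σ k (x i)).map Term.const := by
        simp only [Atom.map, retract_headSubst H.frontier_pattern]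
      rwa [he] at hret
    · exact hγdom.trans fun n hn => ⟨_, Or.inl ⟨a, ha, rfl⟩, hn⟩
    · refine Eq.trans ?_ hβe.symm
      simp only [Atom.map]
      congr 1
      funext i
      exact hm' _ (hav _ (hxa i))
  · rintro ⟨γ, ⟨hγ, hdom⟩, rfl⟩
    refine ⟨H.decode_mem hD hΓ hm hm' hγ, ?_⟩
    rw [Atom.dom_map]
    rintro _ ⟨n, hn, rfl⟩
    have := hdom hn
    rw [Atom.dom_map] at this
    obtain ⟨x, hx, rfl⟩ := this
    rw [hm' x (hav x hx)]
    exact Atom.mem_dom_map hx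

end Describes

end ChildType

/-! ### The correspondence between the two chases -/

section Correspondence

variable {S : Signature.{u}} {C : Type v} {D : Set (Atom S C)} {Γ : Set (TGD S)}

/-- The atom `[τ](t')` of the linearized chase represents the atom `R(t)` of the chase, where `R` is
the predicate of the guard of `τ`. -/
structure Represents (D : Set (Atom S C)) (Γ : Set (TGD S)) (τ : Shape S)
    (t' : Fin (S.arity τ.guard.rel) → Term (linSig S) C)
    (t : Fin (S.arity τ.guard.rel) → Term S C) : Prop where
  mem : (⟨τ.guard.rel, t⟩ : Atom S (Term S C)) ∈ chase D Γ
  isType : τ.IsType Γ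
  pattern : SamePattern t τ.guard.args
  pattern' : SamePattern t' τ.guard.args
  inst : τ.instantiate t = typeOf D Γ ⟨τ.guard.rel, t⟩
  depth : ∀ i, (t' i).depth = (t i).depth

theorem childShape_atoms {σ : TGD S} {k : Var → ℕ} {τ : Shape S} (hΓ : Γ.Finite)
    (hfin : (childDB Γ σ τ k).Finite) {a : Atom S Var} (ha : a ∈ σ.head) :
    (childShape Γ σ τ k a).atoms = Atom.map (rho fun j => headMap Γ σ k (a.args j)) ''
      {γ ∈ completion (childDB Γ σ τ k) Γ | γ.dom ⊆ (a.map (headMap Γ σ k)).dom} := by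
  set α := a.map (headMap Γ σ k) with hα
  have hmem : α ∈ {γ ∈ completion (childDB Γ σ τ k) Γ | γ.dom ⊆ α.dom} := by
    have : α ∈ childDB Γ σ τ k := Or.inl ⟨a, ha, rfl⟩
    exact ⟨⟨toInst_subset_chase hfin hΓ ⟨α, this, rfl⟩, fun n hn => ⟨α, this, hn⟩⟩, subset_rfl⟩
  -- The guard was removed from the rest of the shape; as it belongs to the completion, putting it
  -- back recovers the full set.
  conv_rhs => rw [← Set.insert_eq_of_mem hmem, ← Set.insert_sdiff_singleton, Set.image_insert_eq]
  rfl

theorem childShape_isType {σ : TGD S} (hσ : σ ∈ Γ) {k : Var → ℕ} {τ : Shape S}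
    (hτ : τ.IsType Γ) {a : Atom S Var} (ha : a ∈ σ.head) :
    (childShape Γ σ τ k a).IsType Γ := by
  refine ⟨⟨σ, hσ, a, Or.inr ha, rfl⟩, fun i => ⟨Nat.le_add_left _ _, rho_le_sup _ i⟩, ?_⟩
  rintro _ ⟨β, ⟨⟨hβ, hdom⟩, hne⟩, rfl⟩
  have hguard : (childShape Γ σ τ k a).guard =
      (a.map (headMap Γ σ k)).map (rho fun j => headMap Γ σ k (a.args j)) := rfl
  refine ⟨⟨?_, ?_⟩, ?_⟩
  · rcases (chase_subset_base hβ.1).1 with ⟨b, ⟨c, hc, rfl⟩ | hb, he⟩ | h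
    · exact ⟨σ, hσ, c, Or.inr hc, he⟩
    · have := (hτ.atoms_subset hb).1
      rwa [he] at this
    · exact h
  · rw [hguard, Atom.dom_map, Atom.dom_map]
    exact Set.image_mono hdom
  · rw [hguard]
    exact fun he => hne (Atom.map_injOn (rho_injOn _) hdom subset_rfl he)

theorem depth_headSubst_congr {S' : Signature.{w}} {σ : TGD S} {σ' : TGD S'}
    (hfr : σ'.frontier = σ.frontier) {h : Var → Term S C} {h' : Var → Term S' C}
    (hdepth : ∀ x ∈ σ.frontier, (h' x).depth = (h x).depth) (x : Var) :
    (headSubst σ' h' x).depth = (headSubst σ h x).depth := by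
  by_cases hx : x ∈ σ.frontier
  · rw [headSubst, if_pos (hfr ▸ hx), headSubst, if_pos hx, hdepth x hx]
  · rw [headSubst, if_neg (hfr ▸ hx), headSubst, if_neg hx, Term.depth, Term.depth]
    congr 1
    -- The two suprema are indexed by subtypes of different finsets; generalizing one finset allows
    -- substitution.
    have : ∀ F : Finset Var, F = σ.frontier →
        (Finset.univ.sup fun x : {x // x ∈ F} => (h' x.1).depth) =
        Finset.univ.sup fun x : {x // x ∈ σ.frontier} => (h x.1).depth := by
      rintro _ rfl
      exact Finset.sup_congr rfl fun x _ => hdepth _ x.2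
    exact this _ hfr

/-- The induction step common to both directions of the correspondence: `σ` and its linearization
are fired in parallel. Patterns agree because heads and their integer codes have the same
equalities, and the type condition is `typeOf_head` after renaming by `rho`. -/
theorem Describes.represents_head {σ : TGD S} {h : Var → Term S C} {k : Var → ℕ}
    {T : Set (Atom S ℕ)} (hD : D.Finite) (hΓ : Γ.Finite) (hG : ∀ σ ∈ Γ, σ.Guarded)
    (H : Describes D Γ σ h k T) {h' : Var → Term (linSig S) C}
    (hpat' : ∀ x ∈ σ.bodyVars, ∀ y ∈ σ.bodyVars, (h' x = h' y ↔ k x = k y))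
    (hdepth : ∀ x ∈ σ.bodyVars, (h' x).depth = (h x).depth) {a : Atom S Var} (ha : a ∈ σ.head) :
    Represents D Γ (childShape Γ σ (bodyShape σ k T) k a)
      (fun i => headSubst (linTGD Γ σ k T) h' (a.args i)) (fun i => headSubst σ h (a.args i)) := by
  have hσ := hG σ H.trigger.1
  have hav : ∀ i, a.args i ∈ σ.headVars := fun i => TGD.mem_headVars.2 ⟨a, ha, i, rfl⟩
  have hfb : ∀ x ∈ σ.frontier, x ∈ σ.bodyVars := fun x hx => (TGD.mem_frontier.1 hx).1
  have hfr := frontier_linTGD (Γ := Γ) hσ (h := k) (T := T)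
  have hk : ∀ x ∈ σ.frontier, k x ≤ maxArity Γ := fun x hx => H.bodyVars_le hΓ hG (hfb x hx)
  have hrho : SamePattern (fun i => headMap Γ σ k (a.args i))
      (childShape Γ σ (bodyShape σ k T) k a).guard.args := fun i j =>
    ((rho_injOn fun j => headMap Γ σ k (a.args j)).eq_iff ⟨i, rfl⟩ ⟨j, rfl⟩).symm
  have hpat : SamePattern (fun i => headSubst σ h (a.args i))
      (childShape Γ σ (bodyShape σ k T) k a).guard.args := SamePattern.trans
    (fun i j => headSubst_eq_iff rfl H.frontier_pattern hk (hav i)) hrho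
  have htype := childShape_isType H.trigger.1 H.isType ha (k := k)
  refine ⟨H.headSubst_mem hD hΓ ha, htype, hpat, SamePattern.trans (fun i j => headSubst_eq_iff hfr
    (fun x hx y hy => hpat' x (hfb x hx) y (hfb y hy)) hk (hav i)) hrho, ?_, fun i => ?_⟩
  · obtain ⟨m, hm, hm'⟩ := H.exists_decode hΓ hG
    have hmg : ∀ i, m (k (σ.guard.args i)) = h (σ.guard.args i) := fun i =>
      hm _ ((TGD.mem_bodyVars_iff_guard hσ).2 ⟨i, rfl⟩)
    have : Nonempty (Term S C) := ⟨h 0⟩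
    obtain ⟨f, hf⟩ := exists_fun_of_imp fun i j => (hpat i j).2
    rw [instantiate_eq_image htype.atoms_subset hf,
      childShape_atoms hΓ (Describes.childDB_finite hΓ H.isType) ha]
    refine Eq.trans ?_ (H.typeOf_head hD hΓ hG hmg hm' ha).symm
    rw [Set.image_image]
    refine Set.image_congr fun γ hγ => ?_
    rw [Atom.map_map]
    refine Atom.map_congr fun n hn => ?_
    obtain ⟨i, rfl⟩ := hγ.2 hn
    exact (hf i).trans (hm' _ (hav i)).symm
  · exact depth_headSubst_congr hfr (fun x hx => hdepth x (hfb x hx)) _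

theorem relsOf_subset (hsch : ∀ a ∈ D, a.rel ∈ sch Γ) : relsOf D Γ ⊆ sch Γ := by
  rintro _ (⟨a, ha, rfl⟩ | h)
  · exact hsch a ha
  · exact h

/-- Every fact has a linearization. -/
theorem exists_mem_linDB (hD : D.Finite) (hΓ : Γ.Finite) (hsch : ∀ a ∈ D, a.rel ∈ sch Γ)
    {R : S.Rel} {t : Fin (S.arity R) → C} (ht : (⟨R, t⟩ : Atom S C) ∈ D) :
    ∃ (s : Fin (S.arity R) → ℕ) (T : Set (Atom S ℕ)),
      (⟨⟨⟨R, s⟩, T⟩, t⟩ : Atom (linSig S) C) ∈ linDB Γ D := by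
  -- An arbitrary numbering of the constants of the fact, normalized by `rho`, yields a guard in the
  -- required form; the rest of the type is pulled back along `f`.
  obtain ⟨e, he⟩ := Countable.exists_injective_nat (Set.range t)
  set s₀ : Fin (S.arity R) → ℕ := fun i => e ⟨t i, i, rfl⟩ with hs₀
  set s : Fin (S.arity R) → ℕ := fun i => rho s₀ (s₀ i) with hs
  have hpat : SamePattern t s := fun i j => by
    rw [hs, (rho_injOn s₀).eq_iff ⟨i, rfl⟩ ⟨j, rfl⟩, hs₀, he.eq_iff, Subtype.ext_iff]
  set α : Atom S (Term S C) := ⟨R, fun i => .const (t i)⟩ with hα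
  have : Nonempty (Term S C) := ⟨.const (t ⟨0, S.arity_pos R⟩)⟩
  obtain ⟨f, hf⟩ := exists_fun_of_imp (t := s) (u := fun i => (Term.const (t i) : Term S C))
    fun i j h => congrArg _ ((hpat i j).2 h)
  obtain ⟨g, hg⟩ := exists_fun_of_imp (t := fun i => (Term.const (t i) : Term S C)) (u := s)
    fun i j h => (hpat i j).1 (Term.const.inj h)
  have hαg : (⟨R, s⟩ : Atom S ℕ).map f = α := by
    simp only [Atom.map, hf, hα]
  set T : Set (Atom S ℕ) := {γ | γ.dom ⊆ Set.range s ∧ γ.map f ∈ typeOf D Γ α ∧ γ ≠ ⟨R, s⟩}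
    with hT
  have htype : (⟨⟨R, s⟩, T⟩ : Shape S).IsType Γ := by
    refine ⟨hsch _ ht, fun i => ⟨Nat.le_add_left _ _, rho_le_sup _ i⟩, ?_⟩
    exact fun γ hγ => ⟨⟨relsOf_subset hsch (chase_subset_base hγ.2.1.1).1, hγ.1⟩, hγ.2.2⟩
  refine ⟨s, T, _, t, ht, htype, hpat, ?_, rfl⟩
  rw [instantiate_eq_image htype.atoms_subset hf]
  change _ = typeOf D Γ α
  ext β
  constructor
  · rintro ⟨γ, rfl | hγ, rfl⟩
    · change Atom.map f ⟨R, s⟩ ∈ _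
      rw [hαg]
      exact ⟨toInst_subset_chase hD hΓ ⟨_, ht, rfl⟩, subset_rfl⟩
    · exact hγ.2.1
  · intro hβ
    have hβe : (β.map g).map f = β := by
      refine Atom.map_eq_self (f := fun x => f (g x)) fun x hx => ?_
      obtain ⟨i, rfl⟩ := hβ.2 hx
      exact (congrArg f (hg i)).trans (hf i)
    refine ⟨β.map g, ?_, hβe⟩
    by_cases h : β.map g = ⟨R, s⟩
    · exact Or.inl h
    · refine Or.inr ⟨?_, by rwa [hβe], h⟩
      rw [Atom.dom_map]
      rintro _ ⟨x, hx, rfl⟩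
      obtain ⟨i, rfl⟩ := hβ.2 hx
      exact ⟨i, (hg i).symm⟩

theorem represents_of_mem_linDB (hD : D.Finite) (hΓ : Γ.Finite) {τ : Shape S}
    {t : Fin (S.arity τ.guard.rel) → C} (h : (⟨τ, t⟩ : Atom (linSig S) C) ∈ linDB Γ D) :
    Represents D Γ τ (fun i => .const (t i)) (fun i => .const (t i)) := by
  obtain ⟨τ', t', ht, hτ, hpat, hinst, he⟩ := h
  cases he
  have hp : ∀ {S' : Signature.{u}}, SamePattern (fun i => (Term.const (t i) : Term S' C))
      τ.guard.args := fun i j => by rw [Term.const.injEq]; exact hpat i j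
  exact ⟨toInst_subset_chase hD hΓ ⟨_, ht, rfl⟩, hτ, hp, hp, hinst, fun _ => by simp only [Term.depth]⟩

/-- Every atom of the linearized chase represents an atom of the chase. -/
theorem exists_represented (hD : D.Finite) (hΓ : Γ.Finite) (hG : ∀ σ ∈ Γ, σ.Guarded)
    {b : Atom (linSig S) (Term (linSig S) C)} (hb : b ∈ chase (linDB Γ D) (linSet Γ)) :
    ∃ t, Represents D Γ b.rel b.args t := by
  refine chase_induction (linDB_finite hD hΓ) (linSet_finite hΓ hG)
    (p := fun b => ∃ t, Represents D Γ b.rel b.args t) ?_ ?_ hb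
  · exact fun b hb => ⟨_, represents_of_mem_linDB hD hΓ hb⟩
  · rintro _ h' ⟨⟨σ, hσ, k, T, hτ, hk, rfl⟩, -⟩ ih _ hb'
    obtain ⟨a, ha, rfl⟩ := List.mem_map.1 hb'
    have hg := fun x => TGD.mem_bodyVars_iff_guard (hG σ hσ) (x := x)
    obtain ⟨t, ht⟩ : ∃ t, Represents D Γ (bodyShape σ k T) (fun i => h' (σ.guard.args i)) t :=
      ih _ (List.mem_singleton.2 rfl)
    have : Nonempty (Term S C) := ⟨t ⟨0, S.arity_pos _⟩⟩
    -- Repeated guard variables force equal entries in the linearized atom, hence in `t`, so the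
    -- represented tuple defines a substitution.
    obtain ⟨h, hh⟩ := exists_fun_of_imp (t := σ.guard.args) (u := t) fun i j hij =>
      (ht.pattern i j).2 ((ht.pattern' i j).1 (congrArg h' hij))
    obtain rfl : (fun i => h (σ.guard.args i)) = t := funext hh
    have hpat : ∀ x ∈ σ.bodyVars, ∀ y ∈ σ.bodyVars, (h x = h y ↔ k x = k y) := by
      intro x hx y hy
      obtain ⟨i, rfl⟩ := (hg x).1 hx
      obtain ⟨j, rfl⟩ := (hg y).1 hy
      exact ht.pattern i j
    have hpat' : ∀ x ∈ σ.bodyVars, ∀ y ∈ σ.bodyVars, (h' x = h' y ↔ k x = k y) := by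
      intro x hx y hy
      obtain ⟨i, rfl⟩ := (hg x).1 hx
      obtain ⟨j, rfl⟩ := (hg y).1 hy
      exact ht.pattern' i j
    have H : Describes D Γ σ h k T := by
      -- The side atoms hold in the chase because `k` maps them into the shape, whose instantiation
      -- is the type of the represented atom.
      refine ⟨⟨hσ, fun c hc => ?_⟩, hτ, hpat, ht.inst⟩
      obtain ⟨f, hf⟩ := exists_fun_of_imp fun i j => (ht.pattern i j).2
      have hmem : (c.map k).map f ∈ (bodyShape σ k T).instantiate fun i => h (σ.guard.args i) :=
        ⟨f, hf, _, hk c hc, rfl⟩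
      have hc' : (c.map k).map f ∈ chase D Γ := ((Set.ext_iff.1 ht.inst _).1 hmem).1
      rw [Atom.map_map] at hc'
      refine (Atom.map_congr fun x hx => ?_) ▸ hc'
      obtain ⟨i, rfl⟩ := (hg x).1 (TGD.mem_bodyVars.2 ⟨c, hc, hx⟩)
      exact hf i
    refine ⟨_, H.represents_head hD hΓ hG hpat' (fun x hx => ?_) ha⟩
    obtain ⟨i, rfl⟩ := (hg x).1 hx
    exact ht.depth i

/-- Every atom of the chase is represented by an atom of the linearized chase. -/
theorem exists_representing (hD : D.Finite) (hΓ : Γ.Finite) (hG : ∀ σ ∈ Γ, σ.Guarded)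
    (hsch : ∀ a ∈ D, a.rel ∈ sch Γ) {α : Atom S (Term S C)} (hα : α ∈ chase D Γ) :
    ∃ (τ : Shape S) (t' : Fin (S.arity τ.guard.rel) → Term (linSig S) C)
      (t : Fin (S.arity τ.guard.rel) → Term S C), Represents D Γ τ t' t ∧ ⟨τ.guard.rel, t⟩ = α ∧
      (⟨τ, t'⟩ : Atom (linSig S) (Term (linSig S) C)) ∈ chase (linDB Γ D) (linSet Γ) := by
  have hD' := linDB_finite hD hΓ
  have hΓ' := linSet_finite hΓ hG
  refine chase_induction hD hΓ (p := fun α => ∃ (τ : Shape S)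
    (t' : Fin (S.arity τ.guard.rel) → Term (linSig S) C)
      (t : Fin (S.arity τ.guard.rel) → Term S C), Represents D Γ τ t' t ∧ ⟨τ.guard.rel, t⟩ = α ∧
      (⟨τ, t'⟩ : Atom (linSig S) (Term (linSig S) C)) ∈ chase (linDB Γ D) (linSet Γ)) ?_ ?_ hα
  · rintro ⟨R, t⟩ ha
    obtain ⟨s, T, hmem⟩ := exists_mem_linDB hD hΓ hsch ha
    exact ⟨_, _, _, represents_of_mem_linDB hD hΓ hmem, rfl,
      toInst_subset_chase hD' hΓ' ⟨_, hmem, rfl⟩⟩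
  · intro σ h htr ih a ha
    have hg := fun x => TGD.mem_bodyVars_iff_guard (hG σ htr.1) (x := x)
    -- Only a representative of the guard is needed: its shape records all the side atoms.
    obtain ⟨⟨⟨R, s⟩, T⟩, t', t, ht, he, hmem⟩ := ih _ (TGD.guard_spec (hG σ htr.1)).1
    simp only [Atom.map, Atom.mk.injEq] at he
    obtain ⟨rfl, he⟩ := he
    obtain rfl := eq_of_heq he
    obtain ⟨k, hk⟩ := exists_fun_of_imp (t := σ.guard.args) (u := s) fun i j hij =>
      (ht.pattern i j).1 (congrArg h hij)
    obtain rfl : (fun i => k (σ.guard.args i)) = s := funext hk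
    have : Nonempty (Term (linSig S) C) := ⟨t' ⟨0, S.arity_pos _⟩⟩
    obtain ⟨h', hh'⟩ := exists_fun_of_imp (t := σ.guard.args) (u := t') fun i j hij =>
      (ht.pattern' i j).2 (congrArg k hij)
    obtain rfl : (fun i => h' (σ.guard.args i)) = t' := funext hh'
    have hpat : ∀ x ∈ σ.bodyVars, ∀ y ∈ σ.bodyVars, (h x = h y ↔ k x = k y) := by
      intro x hx y hy
      obtain ⟨i, rfl⟩ := (hg x).1 hx
      obtain ⟨j, rfl⟩ := (hg y).1 hy
      exact ht.pattern i j
    have hpat' : ∀ x ∈ σ.bodyVars, ∀ y ∈ σ.bodyVars, (h' x = h' y ↔ k x = k y) := by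
      intro x hx y hy
      obtain ⟨i, rfl⟩ := (hg x).1 hx
      obtain ⟨j, rfl⟩ := (hg y).1 hy
      exact ht.pattern' i j
    have H : Describes D Γ σ h k T := ⟨htr, ht.isType, hpat, ht.inst⟩
    have hlin : linTGD Γ σ k T ∈ linSet Γ := by
      refine ⟨σ, htr.1, k, T, ht.isType, fun c hc => ?_, rfl⟩
      have : Nonempty (Term S C) := ⟨h 0⟩
      obtain ⟨f, hf⟩ := exists_fun_of_imp fun i j => (ht.pattern i j).2
      have hfinj : Set.InjOn f (bodyShape σ k T).guard.dom := by
        rintro _ ⟨i, rfl⟩ _ ⟨j, rfl⟩ hij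
        exact (ht.pattern i j).1 (((hf i).symm.trans hij).trans (hf j))
      have hcv : ∀ x ∈ c.dom, ∃ i, σ.guard.args i = x := fun x hx =>
        (hg x).1 (TGD.mem_bodyVars.2 ⟨c, hc, hx⟩)
      have hch : c.map h ∈ typeOf D Γ (σ.guard.map h) := by
        refine ⟨htr.2 c hc, ?_⟩
        rw [Atom.dom_map]
        rintro _ ⟨x, hx, rfl⟩
        obtain ⟨i, rfl⟩ := hcv x hx
        exact ⟨i, rfl⟩
      -- The body atoms lie in the type of the guard; injectivity of the decoding on the integers of
      -- the guard pulls them back to atoms of the shape, so `k` is a homomorphism.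
      rw [← H.inst, instantiate_eq_image H.isType.atoms_subset hf] at hch
      obtain ⟨γ, hγ, hγe⟩ := hch
      have hcf : (c.map k).map f = c.map h := by
        rw [Atom.map_map]
        refine Atom.map_congr fun x hx => ?_
        obtain ⟨i, rfl⟩ := hcv x hx
        exact hf i
      have hck : (c.map k).dom ⊆ (bodyShape σ k T).guard.dom := by
        rw [Atom.dom_map]
        rintro _ ⟨x, hx, rfl⟩
        obtain ⟨i, rfl⟩ := hcv x hx
        exact ⟨i, rfl⟩
      rwa [Atom.map_injOn hfinj hck (H.isType.atoms_subset hγ).2 (hcf.trans hγe.symm)]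
    have htr' : IsTrigger (linSet Γ) (chase (linDB Γ D) (linSet Γ)) (linTGD Γ σ k T) h' := by
      refine ⟨hlin, fun b hb => ?_⟩
      obtain rfl := List.mem_singleton.1 hb
      exact hmem
    refine ⟨_, _, _, H.represents_head hD hΓ hG hpat' (fun x hx => ?_) ha, rfl,
      chase_closed hD' hΓ' htr' ⟨_, List.mem_map.2 ⟨a, ha, rfl⟩, rfl⟩⟩
    obtain ⟨i, rfl⟩ := (hg x).1 hx
    exact ht.depth i

end Correspondence

end GuardedChase

/-! ### The proposition -/

theorem mainTheorem7 {S : GuardedChase.Signature.{u}} {C : Type v}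
    (D : Set (GuardedChase.Atom S C)) (Γ : Set (GuardedChase.TGD S))
    (hD : D.Finite) (hΓ : Γ.Finite) (hG : ∀ σ ∈ Γ, σ.Guarded)
    (hsch : ∀ a ∈ D, a.rel ∈ GuardedChase.sch Γ) :
    (Γ ∈ GuardedChase.CTForall D ↔
      GuardedChase.linSet Γ ∈ GuardedChase.CTForall (GuardedChase.linDB Γ D)) ∧
    (Γ ∈ GuardedChase.CTExists D ↔
      GuardedChase.linSet Γ ∈ GuardedChase.CTExists (GuardedChase.linDB Γ D)) ∧
    GuardedChase.maxdepth D Γ =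
      GuardedChase.maxdepth (GuardedChase.linDB Γ D) (GuardedChase.linSet Γ) := by
  refine GuardedChase.termination_congr hD hΓ (GuardedChase.linDB_finite hD hΓ)
    (GuardedChase.linSet_finite hΓ hG) ?_ ?_
  · rintro _ ⟨α, hα, ht⟩
    obtain ⟨τ, t', t, hrep, rfl, hmem⟩ := GuardedChase.exists_representing hD hΓ hG hsch hα
    obtain ⟨i, rfl⟩ := ht
    exact ⟨t' i, ⟨_, hmem, i, rfl⟩, hrep.depth i⟩
  · rintro _ ⟨b, hb, i, rfl⟩
    obtain ⟨t, hrep⟩ := GuardedChase.exists_represented hD hΓ hG hb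
    exact ⟨t i, ⟨_, hrep.mem, i, rfl⟩, (hrep.depth i).symm⟩
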